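/- Let $\mathbb K$ be an algebraically closed field of characteristic zero and let $X$ be an (irreducible) affine variety over $\mathbb K$ with coordinate ring $\mathcal O(X)$. Let $\operatorname{LND}(X)$ be the set of locally nilpotent $\mathbb K$-derivations of $\mathcal O(X)$; every $\mathbb G_a$-action on $X$ has the form $t\mapsto \exp(t\partial)$ for a unique $\partial\in\operatorname{LND}(X)$. Two $\mathbb G_a$-actions $\exp(t\partial_1)$ and $\exp(t\partial_2)$ are called equivalent if $\ker\partial_1=\ker\partial_2$. Let $$\mathcal U(X)=\langle \exp(t\partial)\mid t\in\mathbb K,\ \partial\in\operatorname{LND}(X)\rangle\subset\operatorname{Aut}(X).$$ A derivation $\delta$ of $\mathcal O(X)$ is locally finite if every $f\in\mathcal O(X)$ lies in a finite-dimensional $\delta$-stable subspace of $\mathcal O(X)$. An element $g\in\operatorname{Aut}(X)$ is algebraic if there is an (affine) algebraic group $G$ acting regularly and faithfully on $X$ such that $g$ is the action of an element of $G$. Suppose that $X$ admits two nontrivial $\mathbb G_a$-actions which are not equivalent. Then: (1) there exists a derivation in the $\mathbb K$-linear span of $\operatorname{LND}(X)$ which is not locally finite; (2) there exists a non-algebraic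 element in $\mathcal U(X)$. -/

import Mathlib

/-!
# Locally nilpotent derivations and group actions on an affine variety

Throughout, `K` is the base field and the affine variety `X` is given by its coordinate ring
`A = 𝒪(X)`, a finitely generated `K`-algebra which is a domain.  A regular map `X → X` is the same
as a `K`-algebra homomorphism `A →ₐ[K] A` (its comorphism `f ↦ f ∘ φ`), and `Aut(X)` is
`A ≃ₐ[K] A` (with the order of composition reversed, which affects neither generated subgroups nor
membership in subgroups).
-/

universe u v

namespace AffineVariety

open scoped TensorProduct Polynomial

section Derivations

variable {K : Type u} {A : Type v} [Field K] [CommRing A] [Algebra K A]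

/-- A derivation `δ` is locally finite: every `f` lies in a finite-dimensional `δ`-stable
subspace. -/
def IsLocallyFinite (δ : Derivation K A A) : Prop :=
  ∀ f : A, ∃ V : Submodule K A, FiniteDimensional K V ∧ f ∈ V ∧ ∀ v ∈ V, δ v ∈ V

/-- A derivation `δ` is locally nilpotent: every `f` is killed by some power of `δ`. -/
def IsLocallyNilpotent (δ : Derivation K A A) : Prop :=
  ∀ f : A, ∃ n : ℕ, δ^[n] f = 0

variable (K A) in
/-- The set `LND(X)` of locally nilpotent derivations of `𝒪(X)`. -/
def LND : Set (Derivation K A A) := {δ | IsLocallyNilpotent δ}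

/-- The `n`-th term `(tⁿ / n!) ∂ⁿ f` of `exp(t∂) f`. -/
noncomputable def expTerm (δ : Derivation K A A) (t : K) (n : ℕ) (f : A) : A :=
  (t ^ n / (n.factorial : K)) • δ^[n] f

/-- The exponential `exp(t∂) f = ∑ₙ (tⁿ / n!) ∂ⁿ f`; for locally nilpotent `∂` the sum is finite. -/
noncomputable def expFun (δ : Derivation K A A) (t : K) (f : A) : A :=
  ∑ᶠ n : ℕ, expTerm δ t n f

theorem iterate_eq_zero_of_le (δ : Derivation K A A) {f : A} {n m : ℕ} (h : δ^[n] f = 0)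
    (hnm : n ≤ m) : δ^[m] f = 0 := by
  obtain ⟨k, rfl⟩ := Nat.exists_eq_add_of_le hnm
  rw [add_comm, Function.iterate_add_apply, h, iterate_map_zero]

theorem iterate_smul (δ : Derivation K A A) (c : K) (n : ℕ) (f : A) :
    δ^[n] (c • f) = c • δ^[n] f := by
  induction n with
  | zero => rfl
  | succ n ih => rw [Function.iterate_succ_apply', ih, Function.iterate_succ_apply', Derivation.map_smul]

theorem expTerm_eq_zero (δ : Derivation K A A) (t : K) {f : A} {n m : ℕ} (h : δ^[n] f = 0)
    (hnm : n ≤ m) : expTerm δ t m f = 0 := by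
  rw [expTerm, iterate_eq_zero_of_le δ h hnm, smul_zero]

theorem expFun_eq_sum (δ : Derivation K A A) (t : K) {f : A} {n m : ℕ} (h : δ^[n] f = 0)
    (hnm : n ≤ m) : expFun δ t f = ∑ i ∈ Finset.range m, expTerm δ t i f := by
  apply finsum_eq_sum_of_support_subset
  intro i hi
  simp only [Finset.coe_range, Set.mem_Iio]
  by_contra hlt
  exact hi (expTerm_eq_zero δ t h (hnm.trans (not_lt.1 hlt)))

theorem iterate_mul (δ : Derivation K A A) (n : ℕ) (f g : A) :
    δ^[n] (f * g) =
      ∑ ij ∈ Finset.HasAntidiagonal.antidiagonal n, n.choose ij.1 • (δ^[ij.1] f * δ^[ij.2] g) := by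
  induction n with
  | zero => simp
  | succ n ih =>
    rw [Finset.sum_antidiagonal_choose_succ_nsmul (M := A) (fun i j => δ^[i] f * δ^[j] g) n,
      Function.iterate_succ_apply', ih, map_sum, ← Finset.sum_add_distrib]
    refine Finset.sum_congr rfl fun ij hij => ?_
    rw [map_nsmul, Derivation.leibniz, Function.iterate_succ_apply', Function.iterate_succ_apply',
      nsmul_add, smul_eq_mul, smul_eq_mul, mul_comm (δ^[ij.2] g),
      Nat.choose_symm_of_eq_add (Finset.HasAntidiagonal.mem_antidiagonal.1 hij).symm]

theorem sum_range_sum_range {M : Type v} [AddCommMonoid M] (N : ℕ) (F : ℕ → ℕ → M)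
    (h₁ : ∀ i j, N ≤ i → F i j = 0) (h₂ : ∀ i j, N ≤ j → F i j = 0) :
    ∑ i ∈ Finset.range N, ∑ j ∈ Finset.range N, F i j =
      ∑ n ∈ Finset.range (N + N), ∑ ij ∈ Finset.HasAntidiagonal.antidiagonal n, F ij.1 ij.2 := by
  rw [← Finset.sum_product', ← Finset.sum_fiberwise_of_maps_to
    (s := Finset.range N ×ˢ Finset.range N) (t := Finset.range (N + N)) (g := fun p => p.1 + p.2)]
  · refine Finset.sum_congr rfl fun n _ => ?_
    refine Finset.sum_subset ?_ ?_
    · intro p hp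
      simpa using (Finset.mem_filter.1 hp).2
    · intro p hp hp'
      simp only [Finset.mem_filter, Finset.mem_product, Finset.mem_range,
        Finset.HasAntidiagonal.mem_antidiagonal] at hp hp'
      by_cases hi : N ≤ p.1
      · exact h₁ _ _ hi
      · exact h₂ _ _ (by omega)
  · intro p hp
    simp only [Finset.mem_product, Finset.mem_range] at hp ⊢
    omega

theorem expFun_add_apply {δ : Derivation K A A} (hδ : IsLocallyNilpotent δ) (t : K) (f g : A) :
    expFun δ t (f + g) = expFun δ t f + expFun δ t g := by
  obtain ⟨n, hn⟩ := hδ f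
  obtain ⟨m, hm⟩ := hδ g
  have hfg : δ^[n + m] (f + g) = 0 := by
    rw [iterate_map_add, iterate_eq_zero_of_le δ hn (by omega),
      iterate_eq_zero_of_le δ hm (by omega), add_zero]
  rw [expFun_eq_sum δ t hn (Nat.le_add_right n m), expFun_eq_sum δ t hm (Nat.le_add_left m n),
    expFun_eq_sum δ t hfg le_rfl, ← Finset.sum_add_distrib]
  exact Finset.sum_congr rfl fun i _ => by simp only [expTerm, iterate_map_add, smul_add]

theorem expFun_zero (δ : Derivation K A A) (f : A) : expFun δ 0 f = f := by
  rw [expFun, finsum_eq_single _ 0]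
  · simp [expTerm]
  · intro n hn
    simp [expTerm, zero_pow hn]

theorem expFun_algebraMap (δ : Derivation K A A) (t c : K) :
    expFun δ t (algebraMap K A c) = algebraMap K A c := by
  have h : δ^[1] (algebraMap K A c) = 0 := by simp
  rw [expFun_eq_sum δ t h le_rfl]
  simp [expTerm]

variable [CharZero K]

theorem expTerm_mul (δ : Derivation K A A) (t : K) (n : ℕ) (f g : A) :
    expTerm δ t n (f * g) =
      ∑ ij ∈ Finset.HasAntidiagonal.antidiagonal n, expTerm δ t ij.1 f * expTerm δ t ij.2 g := by
  rw [expTerm, iterate_mul, Finset.smul_sum]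
  refine Finset.sum_congr rfl fun ij hij => ?_
  have hn := Finset.HasAntidiagonal.mem_antidiagonal.1 hij
  rw [expTerm, expTerm, smul_mul_smul_comm, ← Nat.cast_smul_eq_nsmul K, smul_smul]
  congr 1
  subst hn
  rw [Nat.cast_add_choose, pow_add]
  have h0 : ((ij.1 + ij.2).factorial : K) ≠ 0 := Nat.cast_ne_zero.2 (Nat.factorial_ne_zero _)
  have h1 : (ij.1.factorial : K) ≠ 0 := Nat.cast_ne_zero.2 (Nat.factorial_ne_zero _)
  have h2 : (ij.2.factorial : K) ≠ 0 := Nat.cast_ne_zero.2 (Nat.factorial_ne_zero _)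
  field_simp

theorem expTerm_add (δ : Derivation K A A) (s t : K) (n : ℕ) (f : A) :
    expTerm δ (s + t) n f =
      ∑ ij ∈ Finset.HasAntidiagonal.antidiagonal n, expTerm δ s ij.1 (expTerm δ t ij.2 f) := by
  rw [expTerm, (Commute.all s t).add_pow', Finset.sum_div, Finset.sum_smul]
  refine Finset.sum_congr rfl fun ij hij => ?_
  have hn := Finset.HasAntidiagonal.mem_antidiagonal.1 hij
  rw [expTerm, expTerm, iterate_smul, smul_smul, ← Function.iterate_add_apply, hn,
    nsmul_eq_mul]
  congr 1
  subst hn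
  rw [Nat.cast_add_choose]
  have h0 : ((ij.1 + ij.2).factorial : K) ≠ 0 := Nat.cast_ne_zero.2 (Nat.factorial_ne_zero _)
  have h1 : (ij.1.factorial : K) ≠ 0 := Nat.cast_ne_zero.2 (Nat.factorial_ne_zero _)
  have h2 : (ij.2.factorial : K) ≠ 0 := Nat.cast_ne_zero.2 (Nat.factorial_ne_zero _)
  field_simp

theorem expFun_mul_apply {δ : Derivation K A A} (hδ : IsLocallyNilpotent δ) (t : K) (f g : A) :
    expFun δ t (f * g) = expFun δ t f * expFun δ t g := by
  obtain ⟨n, hn⟩ := hδ f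
  obtain ⟨m, hm⟩ := hδ g
  obtain ⟨k, hk⟩ := hδ (f * g)
  set N := n + m + k with hN
  rw [expFun_eq_sum δ t hn (show n ≤ N by omega), expFun_eq_sum δ t hm (show m ≤ N by omega),
    expFun_eq_sum δ t hk (show k ≤ N + N by omega), Finset.sum_mul_sum,
    sum_range_sum_range N (fun i j => expTerm δ t i f * expTerm δ t j g)]
  · exact Finset.sum_congr rfl fun i _ => expTerm_mul δ t i f g
  · intro i j hi
    rw [expTerm_eq_zero δ t hn (by omega), zero_mul]
  · intro i j hj
    rw [expTerm_eq_zero δ t hm (by omega), mul_zero]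

theorem expFun_expFun {δ : Derivation K A A} (hδ : IsLocallyNilpotent δ) (s t : K) (f : A) :
    expFun δ s (expFun δ t f) = expFun δ (s + t) f := by
  obtain ⟨n, hn⟩ := hδ f
  have key : ∀ i, δ^[i] (expFun δ t f) = ∑ j ∈ Finset.range n, δ^[i] (expTerm δ t j f) := by
    intro i
    induction i with
    | zero => simpa using expFun_eq_sum δ t hn le_rfl
    | succ i ih => simp only [Function.iterate_succ_apply', ih, map_sum]
  have hcomm : ∀ i j, δ^[i] (expTerm δ t j f) = (t ^ j / (j.factorial : K)) • δ^[i + j] f := by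
    intro i j
    rw [expTerm, iterate_smul, Function.iterate_add_apply]
  have hz : δ^[n] (expFun δ t f) = 0 := by
    rw [key]
    refine Finset.sum_eq_zero fun j _ => ?_
    rw [hcomm, iterate_eq_zero_of_le δ hn (by omega), smul_zero]
  rw [expFun_eq_sum δ s hz le_rfl, expFun_eq_sum δ (s + t) hn (show n ≤ n + n by omega)]
  simp only [expTerm_add]
  rw [← sum_range_sum_range n (fun i j => expTerm δ s i (expTerm δ t j f))]
  · refine Finset.sum_congr rfl fun i _ => ?_
    rw [expTerm, key, Finset.smul_sum]
    rfl
  · intro i j hi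
    rw [expTerm, hcomm, iterate_eq_zero_of_le δ hn (by omega), smul_zero, smul_zero]
  · intro i j hj
    rw [expTerm, hcomm, iterate_eq_zero_of_le δ hn (by omega), smul_zero, smul_zero]

/-- The automorphism `exp(t∂)` of an affine variety, for `∂` locally nilpotent. -/
noncomputable def expAut (δ : Derivation K A A) (hδ : IsLocallyNilpotent δ) (t : K) :
    A ≃ₐ[K] A where
  toFun := expFun δ t
  invFun := expFun δ (-t)
  left_inv f := by rw [expFun_expFun hδ, neg_add_cancel, expFun_zero]
  right_inv f := by rw [expFun_expFun hδ, add_neg_cancel, expFun_zero]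
  map_mul' := expFun_mul_apply hδ t
  map_add' := expFun_add_apply hδ t
  commutes' := expFun_algebraMap δ t

variable (K A) in
/-- The subgroup `𝒰(X) = ⟨exp(t∂) | t ∈ K, ∂ ∈ LND(X)⟩` of `Aut(X)`. -/
noncomputable def unipotentSubgroup : Subgroup (A ≃ₐ[K] A) :=
  Subgroup.closure
    {g | ∃ (δ : Derivation K A A) (hδ : δ ∈ LND K A) (t : K), g = expAut δ hδ t}

end Derivations

section GaActions

/-- A regular action of the additive group `𝔾ₐ` on `X`, i.e. a morphism
`σ : 𝔾ₐ × X → X`, given by its comorphism `𝒪(X) → 𝒪(𝔾ₐ × X) = 𝒪(X)[T]`, such that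
`σ_0 = id` and `σ_{s+t} = σ_s ∘ σ_t` for all points `s, t` of `𝔾ₐ`. -/
structure GaAction (K : Type u) (A : Type v) [Field K] [CommRing A] [Algebra K A] where
  comorphism : A →ₐ[K] A[X]
  zero_act : ∀ f : A, (comorphism f).eval 0 = f
  add_act : ∀ (s t : K) (f : A),
    (comorphism f).eval (algebraMap K A (s + t)) =
      (comorphism ((comorphism f).eval (algebraMap K A s))).eval (algebraMap K A t)

namespace GaAction

variable {K : Type u} {A : Type v} [Field K] [CommRing A] [Algebra K A]

/-- The action is nontrivial: not every `σ_t` is the identity of `X`. -/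
def IsNontrivial (σ : GaAction K A) : Prop :=
  ∃ (t : K) (f : A), (σ.comorphism f).eval (algebraMap K A t) ≠ f

/-- The derivation `f ↦ d/dt|_{t = 0} (σ_t)^* f` of `𝒪(X)` corresponding to a `𝔾ₐ`-action, so that
`(σ_t)^* = exp(t∂)`. -/
noncomputable def derivation (σ : GaAction K A) : Derivation K A A :=
  Derivation.mk'
    { toFun := fun f => (Polynomial.derivative (σ.comorphism f)).eval 0
      map_add' := fun f g => by simp
      map_smul' := fun c f => by simp }
    (fun f g => by
      simp [σ.zero_act]
      ring)

/-- Two `𝔾ₐ`-actions are equivalent if the corresponding locally nilpotent derivations have the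
same kernel. -/
def Equivalent (σ τ : GaAction K A) : Prop :=
  ∀ f : A, σ.derivation f = 0 ↔ τ.derivation f = 0

end GaAction

end GaActions

section AlgebraicElements

/-- A regular action `G × X → X` of an affine algebraic group `G` with coordinate Hopf algebra `H`,
given by its comorphism `𝒪(X) → 𝒪(G × X) = 𝒪(G) ⊗ 𝒪(X)`; the axioms `e x = x` and
`(g h) x = g (h x)` are the counit and coassociativity identities. -/
structure RegularAction (K : Type u) (H : Type u) (A : Type v) [Field K]
    [CommRing H] [HopfAlgebra K H] [CommRing A] [Algebra K A] where
  comorphism : A →ₐ[K] H ⊗[K] A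
  one_act : (Algebra.TensorProduct.lid K A).toAlgHom.comp
    ((Algebra.TensorProduct.map (Bialgebra.counitAlgHom K H) (AlgHom.id K A)).comp comorphism) =
      AlgHom.id K A
  mul_act : (Algebra.TensorProduct.map (AlgHom.id K H) comorphism).comp comorphism =
    (Algebra.TensorProduct.assoc K K K H H A).toAlgHom.comp
      ((Algebra.TensorProduct.map (Bialgebra.comulAlgHom K H) (AlgHom.id K A)).comp comorphism)

namespace RegularAction

variable {K : Type u} {H : Type u} {A : Type v} [Field K]
  [CommRing H] [HopfAlgebra K H] [CommRing A] [Algebra K A]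

/-- The comorphism of `x ↦ g x`, for a point `g ∈ G(K) = Hom(𝒪(G), K)`. -/
noncomputable def act (ρ : RegularAction K H A) (g : H →ₐ[K] K) : A →ₐ[K] A :=
  (Algebra.TensorProduct.lid K A).toAlgHom.comp
    ((Algebra.TensorProduct.map g (AlgHom.id K A)).comp ρ.comorphism)

/-- The action is faithful: distinct points of `G` act differently on `X`. -/
def IsFaithful (ρ : RegularAction K H A) : Prop :=
  Function.Injective ρ.act

end RegularAction

/-- An automorphism `a` of `X` is algebraic if some algebraic group acting regularly and faithfully
on `X` contains it.  (An algebraic group acting faithfully on an affine variety is affine, hence is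
given by a finitely generated commutative Hopf algebra; up to isomorphism such an algebra lives in
the universe of `K`.) -/
def IsAlgebraicElement {K : Type u} {A : Type v} [Field K] [CommRing A] [Algebra K A]
    (a : A ≃ₐ[K] A) : Prop :=
  ∃ (H : Type u) (_ : CommRing H) (_ : HopfAlgebra K H) (ρ : RegularAction K H A),
    Algebra.FiniteType K H ∧ ρ.IsFaithful ∧ ∃ g : H →ₐ[K] K, ρ.act g = a.toAlgHom

end AlgebraicElements

end AffineVariety

namespace AffineVariety

open scoped TensorProduct Polynomial
open Polynomial

section

/-! Write `∂`, `D` for the derivations of `σ`, `τ`, and let deg be the degree in the parameter of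
the comorphism of `σ`, i.e. the degree function of `∂`. A derivation vanishing on ker `∂` is
proportional to `∂` (`mul_derivation_eq`), so inequivalence gives `f` in ker `∂` outside ker `D`,
and `g` in ker `D` outside ker `∂`. Both conclusions come from degree growth, since degrees are
bounded on a finite-dimensional subspace.

Non-algebraic element: alternate the automorphisms exp(`f ^ k`·`∂`) and exp(`g ^ l`·`D`). For large
`k`, `l` the first makes `g` dominate the degrees of all generators whenever `f` did, the second
does the converse, and the dominating degree strictly grows each time
(`exists_dominates_comp_expAut`). The powers of the product thus move `g` through unbounded degrees,
whereas the orbit of `g` under an algebraic element spans a finite-dimensional space.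

Derivation that is not locally finite: `D` raises degrees by a bounded amount, and `f` can be
rechosen in ker `∂` so that the maximal jump occurs at `f`. Put `θ` = exp(`f`·`∂`), `E` = `g ^
2`·`D` and `δ` = `θ E θ⁻¹ - E`. This has positive degree `e`, attains it at `f`, and `f ∣ δ f`. Were
`δ` locally finite, its action on leading forms would be locally nilpotent, and a locally nilpotent
derivation of a domain with `f ∣ δ f` kills `f` (`not_isLocallyFinite_of_dvd`). -/

theorem natDegree_lt_of_degree_lt {R : Type*} [Semiring R] {p : R[X]} {n : ℕ} (hn : 0 < n)
    (h : p.degree < n) : p.natDegree < n := by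
  rcases eq_or_ne p 0 with rfl | hp
  · rwa [natDegree_zero]
  · exact (natDegree_lt_iff_degree_lt hp).2 h

/-! ### Replicas and conjugates of locally nilpotent derivations. -/

section LocallyNilpotent

variable {K : Type u} {A : Type v} [Field K] [CommRing A] [Algebra K A]

theorem iterate_smul_of_mem_ker {δ : Derivation K A A} {a : A} (ha : δ a = 0) (n : ℕ) (h : A) :
    (a • δ)^[n] h = a ^ n * δ^[n] h := by
  induction n with
  | zero => simp
  | succ n ih =>
    rw [Function.iterate_succ_apply', ih, Function.iterate_succ_apply']
    simp [Derivation.leibniz_pow, ha, pow_succ]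
    ring

theorem IsLocallyNilpotent.smul {δ : Derivation K A A} (hδ : IsLocallyNilpotent δ) {a : A}
    (ha : δ a = 0) : IsLocallyNilpotent (a • δ) := fun h => by
  obtain ⟨n, hn⟩ := hδ h
  exact ⟨n, by rw [iterate_smul_of_mem_ker ha, hn, mul_zero]⟩

theorem map_pow_eq_zero {δ : Derivation K A A} {a : A} (ha : δ a = 0) (n : ℕ) :
    δ (a ^ n) = 0 := by
  simp [Derivation.leibniz_pow, ha]

/-- The derivation `θ ∘ δ ∘ θ⁻¹`. -/
def conjDerivation (θ : A ≃ₐ[K] A) (δ : Derivation K A A) : Derivation K A A :=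
  Derivation.mk' (θ.toLinearMap ∘ₗ δ.toLinearMap ∘ₗ θ.symm.toLinearMap) fun a b => by simp

@[simp]
theorem conjDerivation_apply (θ : A ≃ₐ[K] A) (δ : Derivation K A A) (h : A) :
    conjDerivation θ δ h = θ (δ (θ.symm h)) := rfl

theorem IsLocallyNilpotent.conj {δ : Derivation K A A} (hδ : IsLocallyNilpotent δ)
    (θ : A ≃ₐ[K] A) : IsLocallyNilpotent (conjDerivation θ δ) := fun h => by
  obtain ⟨n, hn⟩ := hδ (θ.symm h)
  have key : ∀ n, (conjDerivation θ δ)^[n] h = θ (δ^[n] (θ.symm h)) := by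
    intro n
    induction n with
    | zero => simp
    | succ n ih => rw [Function.iterate_succ_apply', ih, Function.iterate_succ_apply']; simp
  exact ⟨n, by rw [key, hn, map_zero]⟩

variable [CharZero K]

theorem expAut_smul_apply {δ : Derivation K A A} (hδ : IsLocallyNilpotent δ) {a : A}
    (ha : δ a = 0) {h : A} {n : ℕ} (hn : δ^[n] h = 0) :
    expAut (a • δ) (hδ.smul ha) 1 h =
      ∑ j ∈ Finset.range n, ((j.factorial : K)⁻¹) • (a ^ j * δ^[j] h) := by
  have h0 : (a • δ)^[n] h = 0 := by rw [iterate_smul_of_mem_ker ha, hn, mul_zero]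
  refine (expFun_eq_sum (a • δ) 1 h0 le_rfl).trans (Finset.sum_congr rfl fun j _ => ?_)
  rw [expTerm, iterate_smul_of_mem_ker ha, one_pow, one_div]

end LocallyNilpotent

/-! ### Actions of the additive group as exponentials, local slices and kernels. -/

namespace GaAction

variable {K : Type u} {A : Type v} [Field K] [CommRing A] [Algebra K A]

theorem coeff_zero (σ : GaAction K A) (h : A) : (σ.comorphism h).coeff 0 = h := by
  rw [coeff_zero_eq_eval_zero, σ.zero_act]

theorem comorphism_injective (σ : GaAction K A) : Function.Injective σ.comorphism := fun a b hab => by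
  rw [← σ.coeff_zero a, hab, σ.coeff_zero]

theorem derivation_apply (σ : GaAction K A) (h : A) :
    σ.derivation h = (σ.comorphism h).coeff 1 := by
  have : σ.derivation h = (Polynomial.derivative (σ.comorphism h)).eval 0 := rfl
  rw [this, ← coeff_zero_eq_eval_zero, coeff_derivative]
  simp

variable [CharZero K] [IsDomain A]

/-- The group law says that the comorphism of `p(s)` is `p(X + s)`. Its derivative at `X = 0` gives
`∂(p(s)) = p'(s)` for all `s` in `K`; as `K` is infinite, the coefficients in `s` may be compared.
-/
theorem derivation_coeff (σ : GaAction K A) (h : A) (n : ℕ) :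
    σ.derivation ((σ.comorphism h).coeff n) = (σ.comorphism h).coeff (n + 1) * (n + 1) := by
  have hinj : Function.Injective (algebraMap K A) := FaithfulSMul.algebraMap_injective K A
  have hinf : (Set.range (algebraMap K A)).Infinite := Set.infinite_range_of_injective hinj
  set p := σ.comorphism h with hp
  have hshift : ∀ s : K, σ.comorphism (p.eval (algebraMap K A s)) =
      p.comp (X + C (algebraMap K A s)) := by
    intro s
    refine eq_of_infinite_eval_eq _ _ (hinf.mono ?_)
    rintro _ ⟨t, rfl⟩
    rw [Set.mem_ofPred_eq, ← σ.add_act s t h, eval_comp, map_add, add_comm]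
    simp [hp]
  have hev : ∀ s : K, σ.derivation (p.eval (algebraMap K A s)) =
      (Polynomial.derivative p).eval (algebraMap K A s) := by
    intro s
    have : σ.derivation (p.eval (algebraMap K A s)) =
      (Polynomial.derivative (σ.comorphism (p.eval (algebraMap K A s)))).eval 0 := rfl
    rw [this, hshift]
    simp [derivative_comp]
  have hq : (∑ i ∈ Finset.range (p.natDegree + 1), C (σ.derivation (p.coeff i)) * X ^ i) =
      Polynomial.derivative p := by
    refine eq_of_infinite_eval_eq _ _ (hinf.mono ?_)
    rintro _ ⟨s, rfl⟩
    rw [Set.mem_ofPred_eq, ← hev s, eval_eq_sum_range (p := p), map_sum, eval_finsetSum]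
    refine Finset.sum_congr rfl fun i _ => ?_
    rw [← map_pow, eval_C_mul, eval_X_pow, ← map_pow, Derivation.leibniz,
      Derivation.map_algebraMap, smul_zero, zero_add, smul_eq_mul, mul_comm]
  rw [← coeff_derivative, ← hq]
  simp only [finsetSum_coeff, coeff_C_mul_X_pow, Finset.sum_ite_eq, Finset.mem_range]
  split_ifs with hn
  · rfl
  · rw [coeff_eq_zero_of_natDegree_lt (by omega), map_zero]

theorem comorphism_coeff (σ : GaAction K A) (h : A) (n : ℕ) :
    (σ.comorphism h).coeff n = ((n.factorial : K)⁻¹) • σ.derivation^[n] h := by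
  induction n with
  | zero => simp [σ.coeff_zero]
  | succ n ih =>
    have h1 := σ.derivation_coeff h n
    rw [ih, Derivation.map_smul, ← Function.iterate_succ_apply' (f := σ.derivation)] at h1
    have hn : ((n + 1 : ℕ) : K) ≠ 0 := Nat.cast_ne_zero.2 (Nat.succ_ne_zero n)
    have h2 : (σ.comorphism h).coeff (n + 1) * ((n : A) + 1) =
        ((n + 1 : ℕ) : K) • (σ.comorphism h).coeff (n + 1) := by
      rw [Algebra.smul_def, mul_comm]; simp
    rw [h2] at h1
    rw [Nat.factorial_succ, Nat.cast_mul, mul_inv, mul_smul, h1, smul_smul,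
      inv_mul_cancel₀ hn, one_smul]

theorem iterate_derivation (σ : GaAction K A) (h : A) (n : ℕ) :
    σ.derivation^[n] h = (n.factorial : K) • (σ.comorphism h).coeff n := by
  rw [comorphism_coeff, smul_smul, mul_inv_cancel₀ (Nat.cast_ne_zero.2 n.factorial_ne_zero),
    one_smul]

theorem iterate_derivation_eq_zero (σ : GaAction K A) {h : A} {n : ℕ}
    (hn : (σ.comorphism h).natDegree < n) : σ.derivation^[n] h = 0 := by
  rw [iterate_derivation, coeff_eq_zero_of_natDegree_lt hn, smul_zero]

theorem iterate_derivation_natDegree_ne_zero (σ : GaAction K A) {h : A} (hh : h ≠ 0) :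
    σ.derivation^[(σ.comorphism h).natDegree] h ≠ 0 := by
  rw [iterate_derivation]
  refine smul_ne_zero (Nat.cast_ne_zero.2 (Nat.factorial_ne_zero _)) ?_
  rw [coeff_natDegree, leadingCoeff_ne_zero]
  exact fun h0 => hh (σ.comorphism_injective (by rw [h0, map_zero]))

theorem isLocallyNilpotent (σ : GaAction K A) : IsLocallyNilpotent σ.derivation := fun h =>
  ⟨_, σ.iterate_derivation_eq_zero (Nat.lt_succ_self (σ.comorphism h).natDegree)⟩

theorem derivation_leadingCoeff (σ : GaAction K A) (h : A) :
    σ.derivation (σ.comorphism h).leadingCoeff = 0 := by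
  rw [leadingCoeff, derivation_coeff, coeff_eq_zero_of_natDegree_lt (Nat.lt_succ_self _), zero_mul]

theorem comorphism_of_derivation_eq_zero (σ : GaAction K A) {h : A} (hh : σ.derivation h = 0) :
    σ.comorphism h = C h := by
  ext n
  rw [comorphism_coeff, coeff_C]
  rcases n with _ | n
  · simp
  · rw [Function.iterate_succ_apply, hh, iterate_map_zero, smul_zero, if_neg (Nat.succ_ne_zero n)]

theorem natDegree_eq_zero_iff (σ : GaAction K A) (h : A) :
    (σ.comorphism h).natDegree = 0 ↔ σ.derivation h = 0 := by
  refine ⟨fun h0 => ?_, fun h0 => ?_⟩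
  · rw [derivation_apply, coeff_eq_zero_of_natDegree_lt (by omega)]
  · rw [σ.comorphism_of_derivation_eq_zero h0, natDegree_C]

theorem IsNontrivial.derivation_ne_zero {σ : GaAction K A} (hσ : σ.IsNontrivial) :
    ∃ h, σ.derivation h ≠ 0 := by
  by_contra! h0
  obtain ⟨t, f, hf⟩ := hσ
  exact hf (by rw [σ.comorphism_of_derivation_eq_zero (h0 f), eval_C])

theorem comorphism_local_slice (σ : GaAction K A) {s : A}
    (hs2 : σ.derivation (σ.derivation s) = 0) :
    σ.comorphism s = C (σ.derivation s) * X + C s := by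
  ext m
  rcases m with _ | _ | m
  · simp [σ.coeff_zero]
  · simp [σ.derivation_apply]
  · have h2 : σ.derivation^[2] s = 0 := hs2
    rw [comorphism_coeff, iterate_eq_zero_of_le _ h2 (by omega), smul_zero]
    simp

/-- Division with remainder by a power of a local slice. -/
theorem natDegree_sub_local_slice_pow_lt (σ : GaAction K A) {s : A} (hs : σ.derivation s ≠ 0)
    (hs2 : σ.derivation (σ.derivation s) = 0) {h : A} {n : ℕ} (hpos : 0 < n)
    (hn : (σ.comorphism h).natDegree = n) :
    (σ.comorphism (σ.derivation s ^ n * h - (σ.comorphism h).leadingCoeff * s ^ n)).natDegree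
      < n := by
  have hσs := σ.comorphism_local_slice hs2
  have hdeg : (σ.comorphism s).degree = 1 := by rw [hσs, degree_linear hs]
  have hlc : (σ.comorphism s).leadingCoeff = σ.derivation s := by
    rw [hσs, leadingCoeff_linear hs]
  have hσh : σ.comorphism h ≠ 0 := by rintro h0; simp [h0] at hn; omega
  have hc0 : (σ.comorphism h).leadingCoeff ≠ 0 := leadingCoeff_ne_zero.2 hσh
  rw [map_sub, map_mul, map_mul, σ.comorphism_of_derivation_eq_zero (map_pow_eq_zero hs2 n),
    σ.comorphism_of_derivation_eq_zero (σ.derivation_leadingCoeff h), map_pow σ.comorphism]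
  have hd1 : (C (σ.derivation s ^ n) * σ.comorphism h).degree = n := by
    rw [degree_C_mul (pow_ne_zero _ hs), degree_eq_natDegree hσh, hn]
  have hd2 : (C (σ.comorphism h).leadingCoeff * σ.comorphism s ^ n).degree = n := by
    rw [degree_C_mul hc0, degree_pow, hdeg]; simp
  have := degree_sub_lt_left (hd1.trans hd2.symm)
    (mul_ne_zero (C_ne_zero.2 (pow_ne_zero _ hs)) hσh) (by
      rw [leadingCoeff_mul, leadingCoeff_mul, leadingCoeff_C, leadingCoeff_C,
        leadingCoeff_pow, hlc, mul_comm])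
  rw [hd1] at this
  exact natDegree_lt_of_degree_lt hpos this

/-- A derivation that vanishes on the kernel of a nonzero locally nilpotent derivation `∂` is
proportional to `∂`. -/
theorem mul_derivation_eq (σ : GaAction K A) {s : A} (hs : σ.derivation s ≠ 0)
    (hs2 : σ.derivation (σ.derivation s) = 0) (δ : Derivation K A A)
    (hδ : ∀ h, σ.derivation h = 0 → δ h = 0) (h : A) :
    σ.derivation s * δ h = δ s * σ.derivation h := by
  -- This combination kills `s` and ker `∂`. Division by powers of `s` lowers the degree, so by
  -- induction it kills everything.
  set E : Derivation K A A := σ.derivation s • δ - δ s • σ.derivation with hE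
  have hEs : E s = 0 := by simp [hE, mul_comm]
  have hEk : ∀ h, σ.derivation h = 0 → E h = 0 := fun h hh => by simp [hE, hh, hδ h hh]
  suffices H : ∀ n h, (σ.comorphism h).natDegree = n → E h = 0 by
    have := H _ h rfl
    simpa [hE, sub_eq_zero] using this
  intro n
  induction n using Nat.strong_induction_on with
  | _ n ih =>
    intro h hn
    rcases Nat.eq_zero_or_pos n with h0 | hpos
    · exact hEk h ((σ.natDegree_eq_zero_iff h).1 (hn.trans h0))
    have hEr := ih _ (σ.natDegree_sub_local_slice_pow_lt hs hs2 hpos hn) _ rfl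
    rw [map_sub, Derivation.leibniz, Derivation.leibniz, hEk _ (map_pow_eq_zero hs2 n),
      hEk _ (σ.derivation_leadingCoeff h), Derivation.leibniz_pow, hEs] at hEr
    simpa [hs] using hEr

/-- The last but one nonzero iterate of the derivation on an element outside the kernel is such an
`s`. -/
theorem exists_local_slice (σ : GaAction K A) (hσ : σ.IsNontrivial) :
    ∃ s, σ.derivation s ≠ 0 ∧ σ.derivation (σ.derivation s) = 0 := by
  obtain ⟨h, hh⟩ := hσ.derivation_ne_zero
  have hn : (σ.comorphism h).natDegree ≠ 0 := fun h0 => hh ((σ.natDegree_eq_zero_iff h).1 h0)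
  obtain ⟨m, hm⟩ := Nat.exists_eq_succ_of_ne_zero hn
  refine ⟨σ.derivation^[m] h, ?_, ?_⟩
  · rw [← Function.iterate_succ_apply' (f := σ.derivation), ← hm]
    exact σ.iterate_derivation_natDegree_ne_zero (fun h0 => hh (by rw [h0, map_zero]))
  · rw [← Function.iterate_succ_apply' (f := σ.derivation),
      ← Function.iterate_succ_apply' (f := σ.derivation)]
    exact σ.iterate_derivation_eq_zero (by omega)

/-- Proportionality reads `∂s · D = Ds · ∂`. Nontriviality of `τ` forces `Ds ≠ 0`, so the two
kernels agree. -/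
theorem ker_le_of_ker_le {σ τ : GaAction K A} (hσ : σ.IsNontrivial) (hτ : τ.IsNontrivial)
    (hle : ∀ h, σ.derivation h = 0 → τ.derivation h = 0) (h : A) (hh : τ.derivation h = 0) :
    σ.derivation h = 0 := by
  obtain ⟨s, hs, hs2⟩ := σ.exists_local_slice hσ
  have key := σ.mul_derivation_eq hs hs2 τ.derivation hle
  by_contra hne
  have h1 := key h
  rw [hh, mul_zero, eq_comm, mul_eq_zero, or_iff_left hne] at h1
  obtain ⟨x, hx⟩ := hτ.derivation_ne_zero
  have h2 := key x
  rw [h1, zero_mul, mul_eq_zero, or_iff_left hx] at h2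
  exact hs h2

theorem exists_mem_ker_not_mem_ker {σ τ : GaAction K A} (hσ : σ.IsNontrivial)
    (hτ : τ.IsNontrivial) (hne : ¬ σ.Equivalent τ) :
    ∃ f, σ.derivation f = 0 ∧ τ.derivation f ≠ 0 := by
  by_contra! hle
  exact hne fun h => ⟨hle h, ker_le_of_ker_le hσ hτ hle h⟩

end GaAction

end

/-! ### Algebraic elements: orbits of functions span finite-dimensional spaces. -/

section

namespace RegularAction

variable {K : Type u} {H : Type u} {A : Type v} [Field K]
  [CommRing H] [HopfAlgebra K H] [CommRing A] [Algebra K A]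

theorem act_apply (ρ : RegularAction K H A) (g : H →ₐ[K] K) (a : A) :
    ρ.act g a = TensorProduct.lid K A
      (Algebra.TensorProduct.map g (AlgHom.id K A) (ρ.comorphism a)) := rfl

theorem act_counit (ρ : RegularAction K H A) :
    ρ.act (Bialgebra.counitAlgHom K H) = AlgHom.id K A := ρ.one_act

/-- The points of the group are closed under multiplication. -/
theorem exists_act_eq_comp (ρ : RegularAction K H A) (g g' : H →ₐ[K] K) :
    ∃ g'' : H →ₐ[K] K, ρ.act g'' = (ρ.act g').comp (ρ.act g) := by
  refine ⟨(Algebra.TensorProduct.lift g g' fun _ _ => Commute.all _ _).comp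
    (Bialgebra.comulAlgHom K H), AlgHom.ext fun a => ?_⟩
  have h := congrArg (fun φ : A →ₐ[K] H ⊗[K] (H ⊗[K] A) => φ a) ρ.mul_act
  -- Coassociativity is contracted with `g` on the first factor and `g'` on the second; `hl` and
  -- `hr` evaluate the two sides.
  have h' := congrArg (fun z => TensorProduct.lid K A (Algebra.TensorProduct.map g
    ((Algebra.TensorProduct.lid K A).toAlgHom.comp
      (Algebra.TensorProduct.map g' (AlgHom.id K A))) z)) h
  have hl : ∀ z : H ⊗[K] A, TensorProduct.lid K A (Algebra.TensorProduct.map g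
      ((Algebra.TensorProduct.lid K A).toAlgHom.comp
        (Algebra.TensorProduct.map g' (AlgHom.id K A)))
        (Algebra.TensorProduct.map (AlgHom.id K H) ρ.comorphism z)) =
      ρ.act g' (TensorProduct.lid K A (Algebra.TensorProduct.map g (AlgHom.id K A) z)) := by
    intro z
    induction z using TensorProduct.induction_on with
    | zero => simp
    | tmul x y => simp [act_apply]; rfl
    | add x y hx hy => simp only [map_add, hx, hy]
  have hr : ∀ z : (H ⊗[K] H) ⊗[K] A, TensorProduct.lid K A (Algebra.TensorProduct.map g
      ((Algebra.TensorProduct.lid K A).toAlgHom.comp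
        (Algebra.TensorProduct.map g' (AlgHom.id K A)))
        (Algebra.TensorProduct.assoc K K K H H A z)) =
      TensorProduct.lid K A (Algebra.TensorProduct.map
        (Algebra.TensorProduct.lift g g' fun _ _ => Commute.all _ _) (AlgHom.id K A) z) := by
    intro z
    induction z using TensorProduct.induction_on with
    | zero => simp
    | tmul w y =>
      induction w using TensorProduct.induction_on with
      | zero => simp
      | tmul x x' => simpa [mul_smul] using smul_comm (g' x') (g x) y
      | add x y hx hy => simp only [map_add, TensorProduct.add_tmul, hx, hy]
    | add x y hx hy => simp only [map_add, hx, hy]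
  have hc : ∀ z : H ⊗[K] A, Algebra.TensorProduct.map
        (Algebra.TensorProduct.lift g g' fun _ _ => Commute.all _ _) (AlgHom.id K A)
        (Algebra.TensorProduct.map (Bialgebra.comulAlgHom K H) (AlgHom.id K A) z) =
      Algebra.TensorProduct.map ((Algebra.TensorProduct.lift g g' fun _ _ => Commute.all _ _).comp
        (Bialgebra.comulAlgHom K H)) (AlgHom.id K A) z := by
    intro z
    induction z using TensorProduct.induction_on with
    | zero => simp
    | tmul x y => simp
    | add x y hx hy => simp only [map_add, hx, hy]
  have h1 := hl (ρ.comorphism a)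
  have h2 := hr (Algebra.TensorProduct.map (Bialgebra.comulAlgHom K H) (AlgHom.id K A)
    (ρ.comorphism a))
  rw [hc] at h2
  exact h2.symm.trans (h'.symm.trans h1)

/-- The orbit of a regular function under a regular action spans a finite-dimensional space. -/
theorem exists_finiteDimensional_act_mem (ρ : RegularAction K H A) (a : A) :
    ∃ V : Submodule K A, FiniteDimensional K V ∧ ∀ g, ρ.act g a ∈ V := by
  suffices h : ∀ z : H ⊗[K] A, ∃ V : Submodule K A, FiniteDimensional K V ∧ ∀ g : H →ₐ[K] K,
      TensorProduct.lid K A (Algebra.TensorProduct.map g (AlgHom.id K A) z) ∈ V from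
    h (ρ.comorphism a)
  intro z
  induction z using TensorProduct.induction_on with
  | zero => exact ⟨⊥, inferInstance, fun g => by simp⟩
  | tmul x y =>
    refine ⟨Submodule.span K {y}, FiniteDimensional.span_of_finite K (Set.finite_singleton y),
      fun g => ?_⟩
    simpa using Submodule.smul_mem _ (g x) (Submodule.mem_span_singleton_self y)
  | add x y hx hy =>
    obtain ⟨V, hV, hx⟩ := hx
    obtain ⟨W, hW, hy⟩ := hy
    exact ⟨V ⊔ W, inferInstance, fun g => by
      rw [map_add, map_add]; exact Submodule.add_mem_sup (hx g) (hy g)⟩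

end RegularAction

section

variable {K : Type u} {A : Type v} [Field K] [CommRing A] [Algebra K A]

/-- All powers of `a` are again given by points of the group, so they share the space that contains
the whole orbit of `h`. -/
theorem IsAlgebraicElement.exists_finiteDimensional {a : A ≃ₐ[K] A} (ha : IsAlgebraicElement a)
    (h : A) : ∃ V : Submodule K A, FiniteDimensional K V ∧ ∀ n : ℕ, (a ^ n) h ∈ V := by
  obtain ⟨H, _, _, ρ, -, -, g, hg⟩ := ha
  obtain ⟨V, hV, hmem⟩ := ρ.exists_finiteDimensional_act_mem h
  have hpow : ∀ n : ℕ, ∃ g' : H →ₐ[K] K, ∀ x, ρ.act g' x = (a ^ n) x := by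
    intro n
    induction n with
    | zero => exact ⟨_, fun x => by rw [ρ.act_counit]; simp⟩
    | succ n ih =>
      obtain ⟨g', hg'⟩ := ih
      obtain ⟨g'', h''⟩ := ρ.exists_act_eq_comp g g'
      refine ⟨g'', fun x => ?_⟩
      rw [h'', AlgHom.comp_apply, hg', hg, pow_succ]
      rfl
  refine ⟨V, hV, fun n => ?_⟩
  obtain ⟨g', hg'⟩ := hpow n
  rw [← hg']
  exact hmem g'

/-- The degree is bounded on a finite-dimensional space. -/
theorem exists_natDegree_le_of_finiteDimensional (Φ : A →ₐ[K] A[X]) (V : Submodule K A)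
    [FiniteDimensional K V] : ∃ N, ∀ v ∈ V, (Φ v).natDegree ≤ N := by
  obtain ⟨S, hS⟩ := (Submodule.fg_top V).1 (Module.Finite.fg_top (R := K) (M := V))
  refine ⟨S.sup fun s => (Φ s).natDegree, fun v hv => ?_⟩
  rw [← hS] at hv
  induction hv using Submodule.span_induction with
  | mem x hx => exact Finset.le_sup (f := fun s => (Φ s).natDegree) hx
  | zero => simp
  | add x y _ _ hx hy =>
    rw [map_add]; exact (natDegree_add_le _ _).trans (max_le hx hy)
  | smul c x _ hx => rw [map_smul]; exact (natDegree_smul_le _ _).trans hx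

end

end

/-! ### Degree growth under alternating shears: the non-algebraic element. -/

section

section DegreeGrowth

variable {K : Type u} {A : Type v} [Field K] [CommRing A] [Algebra K A]

/-- Express `h` as a polynomial in the generators: `c` depends on this expression only. Uniformity
in `Φ` is what allows one exponent `k` to serve all steps of the later iteration. -/
theorem exists_natDegree_le_mul {S : Set A} (hS : Algebra.adjoin K S = ⊤) (h : A) :
    ∃ c : ℕ, ∀ (Φ : A →ₐ[K] A[X]) (m : ℕ), (∀ s ∈ S, (Φ s).natDegree ≤ m) →
      (Φ h).natDegree ≤ c * m := by
  have hh : h ∈ Algebra.adjoin K S := hS ▸ Algebra.mem_top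
  induction hh using Algebra.adjoin_induction with
  | mem x hx => exact ⟨1, fun Φ m hm => by simpa using hm x hx⟩
  | algebraMap r =>
    refine ⟨0, fun Φ m _ => ?_⟩
    rw [AlgHom.commutes, Polynomial.algebraMap_apply, natDegree_C, zero_mul]
  | add x y _ _ hx hy =>
    obtain ⟨c, hc⟩ := hx
    obtain ⟨d, hd⟩ := hy
    refine ⟨max c d, fun Φ m hm => ?_⟩
    rw [map_add]
    refine (natDegree_add_le _ _).trans (max_le ?_ ?_)
    · exact (hc Φ m hm).trans (Nat.mul_le_mul_right _ (le_max_left _ _))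
    · exact (hd Φ m hm).trans (Nat.mul_le_mul_right _ (le_max_right _ _))
  | mul x y _ _ hx hy =>
    obtain ⟨c, hc⟩ := hx
    obtain ⟨d, hd⟩ := hy
    refine ⟨c + d, fun Φ m hm => ?_⟩
    rw [map_mul, add_mul]
    exact natDegree_mul_le.trans (add_le_add (hc Φ m hm) (hd Φ m hm))

theorem exists_natDegree_iterate_le_mul {S : Set A} (hS : Algebra.adjoin K S = ⊤)
    {δ : Derivation K A A} (hδ : IsLocallyNilpotent δ) (T : Finset A) :
    ∃ c : ℕ, ∀ h ∈ T, ∀ j : ℕ, ∀ (Φ : A →ₐ[K] A[X]) (m : ℕ),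
      (∀ s ∈ S, (Φ s).natDegree ≤ m) → (Φ (δ^[j] h)).natDegree ≤ c * m := by
  choose c hc using exists_natDegree_le_mul (K := K) hS
  choose N hN using hδ
  refine ⟨T.sup fun h => (Finset.range (N h)).sup fun j => c (δ^[j] h), fun h hh j Φ m hm => ?_⟩
  rcases lt_or_ge j (N h) with hj | hj
  · refine (hc _ Φ m hm).trans (Nat.mul_le_mul_right _ ?_)
    exact (Finset.le_sup (f := fun j => c (δ^[j] h)) (Finset.mem_range.2 hj)).trans
      (Finset.le_sup (f := fun h => (Finset.range (N h)).sup fun j => c (δ^[j] h)) hh)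
  · rw [iterate_eq_zero_of_le δ (hN h) hj]; simp

/-- The degree function `natDegree ∘ Φ` is controlled, up to the factor `κ`, by its positive value
at `f`. -/
def Dominates (S : Finset A) (κ : ℕ) (Φ : A →ₐ[K] A[X]) (f : A) : Prop :=
  1 ≤ (Φ f).natDegree ∧ ∀ s ∈ S, (Φ s).natDegree ≤ κ * (Φ f).natDegree

variable [CharZero K] [IsDomain A]

/-- After a large shear along `∂`, controlled by `f ∈ ker ∂`, the degree is controlled by any
given `g ∉ ker ∂`. -/
theorem exists_dominates_comp_expAut {S : Finset A} (hS : Algebra.adjoin K (S : Set A) = ⊤)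
    (σ : GaAction K A) {f g : A} (hf : σ.derivation f = 0) (hg : σ.derivation g ≠ 0) {κ : ℕ}
    (hκ : ∀ s ∈ S, (σ.comorphism s).natDegree < κ) :
    ∃ k : ℕ, ∀ Φ : A →ₐ[K] A[X], Function.Injective Φ → Dominates S κ Φ f →
      Dominates S κ (Φ.comp (expAut (f ^ k • σ.derivation)
        (σ.isLocallyNilpotent.smul (map_pow_eq_zero hf k)) 1).toAlgHom) g ∧
      (Φ f).natDegree < (Φ (expAut (f ^ k • σ.derivation)
        (σ.isLocallyNilpotent.smul (map_pow_eq_zero hf k)) 1 g)).natDegree := by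
  classical
  obtain ⟨c, hc⟩ := exists_natDegree_iterate_le_mul hS σ.isLocallyNilpotent (insert g S)
  -- With `n = deg Φ f`, the `j`-th term of `Φ (θ h)` has degree at most `kjn + cκn`, and at least
  -- `kjn` if nonzero. Since `k > cκ`, the last nonzero term wins; the extra 2 gives `kn > n` even
  -- if `c = 0`.
  refine ⟨c * κ + 2, fun Φ hΦ hdom => ?_⟩
  set k := c * κ + 2 with hk
  set n := (Φ f).natDegree with hn
  obtain ⟨hn1, hdS⟩ := hdom
  set θ := expAut (f ^ k • σ.derivation)
        (σ.isLocallyNilpotent.smul (map_pow_eq_zero hf k)) 1 with hθ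
  have hΦf : Φ f ≠ 0 := fun h0 => by rw [h0] at hn1; simp at hn1
  have hterm : ∀ h ∈ insert g S, ∀ j, (Φ (σ.derivation^[j] h)).natDegree ≤ c * κ * n :=
    fun h hh j => by rw [mul_assoc]; exact hc h hh j Φ _ hdS
  have hexp : ∀ h m, (σ.comorphism h).natDegree < m → Φ (θ h) =
      ∑ j ∈ Finset.range m, ((j.factorial : K)⁻¹) • (Φ f ^ (k * j) * Φ (σ.derivation^[j] h)) := by
    intro h m hm
    rw [hθ, expAut_smul_apply σ.isLocallyNilpotent (map_pow_eq_zero hf k)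
      (σ.iterate_derivation_eq_zero hm), map_sum]
    refine Finset.sum_congr rfl fun j _ => ?_
    rw [map_smul, map_mul, map_pow, map_pow, pow_mul]
  have hle : ∀ h ∈ insert g S, ∀ j, (((j.factorial : K)⁻¹) •
      (Φ f ^ (k * j) * Φ (σ.derivation^[j] h))).natDegree ≤ k * j * n + c * κ * n := by
    intro h hh j
    refine (natDegree_smul_le _ _).trans (natDegree_mul_le.trans ?_)
    rw [natDegree_pow]
    exact Nat.add_le_add_left (hterm h hh j) _
  have hbig : k * n ≤ (Φ (θ g)).natDegree := by
    have hg0 : g ≠ 0 := fun h0 => hg (by rw [h0, map_zero])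
    obtain ⟨b, hb⟩ := Nat.exists_eq_succ_of_ne_zero
      (fun h0 => hg ((σ.natDegree_eq_zero_iff g).1 h0))
    have htop : k * (b + 1) * n ≤ (((b + 1).factorial : K)⁻¹ • (Φ f ^ (k * (b + 1)) *
        Φ (σ.derivation^[b + 1] g))).natDegree := by
      rw [natDegree_smul _ (inv_ne_zero (Nat.cast_ne_zero.2 (Nat.factorial_ne_zero _))),
        natDegree_mul (pow_ne_zero _ hΦf), natDegree_pow]
      · exact Nat.le_add_right _ _
      · rw [← Nat.succ_eq_add_one, ← hb]
        exact fun h0 => σ.iterate_derivation_natDegree_ne_zero hg0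
          (hΦ (by rw [h0, map_zero]))
    have hlow : (∑ j ∈ Finset.range (b + 1), ((j.factorial : K)⁻¹) •
        (Φ f ^ (k * j) * Φ (σ.derivation^[j] g))).natDegree ≤ k * b * n + c * κ * n := by
      refine natDegree_sum_le_of_forall_le _ _ fun j hj => ?_
      refine (hle g (Finset.mem_insert_self _ _) j).trans ?_
      have : j ≤ b := Nat.lt_succ_iff.1 (Finset.mem_range.1 hj)
      gcongr
    -- The top term, of index `b + 1 = deg g`, has larger degree than the sum of the others.
    rw [hexp g (b + 2) (by omega), Finset.sum_range_succ, natDegree_add_eq_right_of_natDegree_lt]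
    · refine le_trans ?_ htop
      nlinarith [Nat.zero_le (k * b * n)]
    · refine lt_of_le_of_lt hlow (lt_of_lt_of_le ?_ htop)
      have : k * (b + 1) * n = k * b * n + c * κ * n + 2 * n := by rw [hk]; ring
      omega
  refine ⟨⟨?_, fun s hs => ?_⟩, ?_⟩
  · refine le_trans ?_ hbig
    nlinarith
  · refine le_trans ?_ (Nat.mul_le_mul_left κ hbig)
    change (Φ (θ s)).natDegree ≤ _
    rw [hexp s κ (hκ s hs)]
    refine natDegree_sum_le_of_forall_le _ _ fun j hj => ?_
    refine (hle s (Finset.mem_insert_of_mem hs) j).trans ?_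
    -- Here `κ = j + r + 1`: since `j < κ`, there is room for the error `cκn` inside one further
    -- `kn`.
    obtain ⟨r, rfl⟩ := Nat.exists_eq_add_of_lt (Finset.mem_range.1 hj)
    have h1 : (j + r + 1) * (k * n) = k * j * n + r * (k * n) + k * n := by ring
    have h2 : k * n = c * (j + r + 1) * n + 2 * n := by rw [hk]; ring
    omega
  · refine lt_of_lt_of_le ?_ hbig
    nlinarith [Nat.zero_le (c * κ * n)]

theorem exists_not_isAlgebraicElement [Algebra.FiniteType K A] (σ τ : GaAction K A) {f g : A}
    (hf : σ.derivation f = 0) (hf' : τ.derivation f ≠ 0) (hg : τ.derivation g = 0)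
    (hg' : σ.derivation g ≠ 0) :
    ∃ a ∈ unipotentSubgroup K A, ¬ IsAlgebraicElement a := by
  obtain ⟨S, hS⟩ := Algebra.FiniteType.out (R := K) (A := A)
  set κ := (S.sup fun s => (σ.comorphism s).natDegree) +
    (S.sup fun s => (τ.comorphism s).natDegree) + 1 with hκ
  have hσκ : ∀ s ∈ S, (σ.comorphism s).natDegree < κ := fun s hs => by
    have := Finset.le_sup (f := fun s => (σ.comorphism s).natDegree) hs
    omega
  have hτκ : ∀ s ∈ S, (τ.comorphism s).natDegree < κ := fun s hs => by
    have := Finset.le_sup (f := fun s => (τ.comorphism s).natDegree) hs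
    omega
  obtain ⟨k, hk⟩ := exists_dominates_comp_expAut hS σ hf hg' hσκ
  obtain ⟨l, hl⟩ := exists_dominates_comp_expAut hS τ hg hf' hτκ
  set θ := expAut (f ^ k • σ.derivation)
    (σ.isLocallyNilpotent.smul (map_pow_eq_zero hf k)) 1
  set η := expAut (g ^ l • τ.derivation)
    (τ.isLocallyNilpotent.smul (map_pow_eq_zero hg l)) 1
  refine ⟨η * θ, mul_mem (Subgroup.subset_closure ⟨_, _, _, rfl⟩)
    (Subgroup.subset_closure ⟨_, _, _, rfl⟩), fun halg => ?_⟩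
  obtain ⟨V, hV, hmem⟩ := halg.exists_finiteDimensional g
  obtain ⟨N, hN⟩ := exists_natDegree_le_of_finiteDimensional σ.comorphism V
  -- As `(η * θ) ^ (n + 1)` is `(η * θ) ^ n ∘ η ∘ θ`, precomposing with `η` passes control from `g`
  -- to `f`, and precomposing with `θ` returns it to `g`.
  have key : ∀ n : ℕ, Dominates S κ (σ.comorphism.comp ((η * θ) ^ n).toAlgHom) g ∧
      n ≤ (σ.comorphism (((η * θ) ^ n) g)).natDegree := by
    intro n
    induction n with
    | zero =>
      have h1 : 1 ≤ (σ.comorphism g).natDegree :=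
        Nat.one_le_iff_ne_zero.2 fun h0 => hg' ((σ.natDegree_eq_zero_iff g).1 h0)
      exact ⟨⟨h1, fun s hs => (hσκ s hs).le.trans (Nat.le_mul_of_pos_right _ h1)⟩, Nat.zero_le _⟩
    | succ n ih =>
      obtain ⟨ih1, ih2⟩ := ih
      have hinj : Function.Injective (σ.comorphism.comp ((η * θ) ^ n).toAlgHom) :=
        σ.comorphism_injective.comp ((η * θ) ^ n).injective
      obtain ⟨h1, h2⟩ := hl _ hinj ih1
      obtain ⟨h3, h4⟩ :=
        hk ((σ.comorphism.comp ((η * θ) ^ n).toAlgHom).comp η.toAlgHom) (hinj.comp η.injective) h1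
      have he : (σ.comorphism.comp ((η * θ) ^ (n + 1)).toAlgHom) =
          ((σ.comorphism.comp ((η * θ) ^ n).toAlgHom).comp η.toAlgHom).comp θ.toAlgHom := by
        rw [pow_succ]; rfl
      refine ⟨he ▸ h3, ?_⟩
      have h5 : σ.comorphism (((η * θ) ^ (n + 1)) g) =
        (((σ.comorphism.comp ((η * θ) ^ n).toAlgHom).comp η.toAlgHom)) (θ g) := by
        rw [pow_succ]; rfl
      rw [h5]
      exact Nat.succ_le_of_lt (lt_of_le_of_lt (ih2.trans h2.le) h4)
  have h1 := (key (N + 1)).2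
  have h2 := hN _ (hmem (N + 1))
  omega

end DegreeGrowth

end

/-! ### Leading forms of a derivation that raises degrees boundedly. -/

section

variable {K : Type u} {A : Type v} [Field K] [CommRing A] [Algebra K A]

namespace GaAction

/-- The component of degree `n * e` of the action of `δ ^ n` on the leading form of `h`, for a
derivation `δ` raising the degree of `σ` by at most `e`. -/
noncomputable def topCoeff (σ : GaAction K A) (δ : Derivation K A A) (e : ℕ) (h : A) (n : ℕ) : A :=
  (σ.comorphism (δ^[n] h)).coeff ((σ.comorphism h).natDegree + n * e)

theorem natDegree_iterate_le {σ : GaAction K A} {δ : Derivation K A A} {e : ℕ}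
    (hδ : ∀ h, (σ.comorphism (δ h)).natDegree ≤ (σ.comorphism h).natDegree + e) (h : A) (n : ℕ) :
    (σ.comorphism (δ^[n] h)).natDegree ≤ (σ.comorphism h).natDegree + n * e := by
  induction n with
  | zero => simp
  | succ n ih =>
    rw [Function.iterate_succ_apply', add_mul, one_mul, ← add_assoc]
    exact (hδ _).trans (Nat.add_le_add_right ih e)

theorem topCoeff_zero (σ : GaAction K A) (δ : Derivation K A A) (e : ℕ) (h : A) :
    σ.topCoeff δ e h 0 = (σ.comorphism h).leadingCoeff := by
  simp [topCoeff]

theorem comorphism_ne_zero (σ : GaAction K A) {h : A} (hh : h ≠ 0) : σ.comorphism h ≠ 0 :=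
  fun h0 => hh (σ.comorphism_injective (by rw [h0, map_zero]))

theorem topCoeff_eventually_zero {σ : GaAction K A} {δ : Derivation K A A} {e : ℕ} (he : 0 < e)
    (hlf : IsLocallyFinite δ) (h : A) :
    ∃ N, ∀ n, N < n → σ.topCoeff δ e h n = 0 := by
  obtain ⟨V, hV, hhV, hstab⟩ := hlf h
  obtain ⟨N, hN⟩ := exists_natDegree_le_of_finiteDimensional σ.comorphism V
  refine ⟨N, fun n hn => coeff_eq_zero_of_natDegree_lt ?_⟩
  have hmem : ∀ n : ℕ, δ^[n] h ∈ V := by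
    intro n
    induction n with
    | zero => exact hhV
    | succ n ih => rw [Function.iterate_succ_apply']; exact hstab _ ih
  have := hN _ (hmem n)
  nlinarith

section

variable [IsDomain A]

/-- Degrees add in a domain, so top coefficients obey the Leibniz rule of the homogeneous derivation
induced on leading forms. -/
theorem topCoeff_mul {σ : GaAction K A} {δ : Derivation K A A} {e : ℕ}
    (hδ : ∀ h, (σ.comorphism (δ h)).natDegree ≤ (σ.comorphism h).natDegree + e) {a b : A}
    (ha : a ≠ 0) (hb : b ≠ 0) (n : ℕ) :
    σ.topCoeff δ e (a * b) n = ∑ ij ∈ Finset.HasAntidiagonal.antidiagonal n,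
      n.choose ij.1 • (σ.topCoeff δ e a ij.1 * σ.topCoeff δ e b ij.2) := by
  rw [topCoeff, iterate_mul, map_sum, finsetSum_coeff]
  refine Finset.sum_congr rfl fun ij hij => ?_
  have hn := Finset.HasAntidiagonal.mem_antidiagonal.1 hij
  rw [map_nsmul, coeff_smul, map_mul, map_mul,
    natDegree_mul (σ.comorphism_ne_zero ha) (σ.comorphism_ne_zero hb), topCoeff, topCoeff,
    ← coeff_mul_add_eq_of_natDegree_le (natDegree_iterate_le hδ a ij.1)
      (natDegree_iterate_le hδ b ij.2)]
  congr 2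
  rw [← hn]
  ring

theorem topCoeff_mul_one {σ : GaAction K A} {δ : Derivation K A A} {e : ℕ}
    (hδ : ∀ h, (σ.comorphism (δ h)).natDegree ≤ (σ.comorphism h).natDegree + e) {a b : A}
    (ha : a ≠ 0) (hb : b ≠ 0) :
    σ.topCoeff δ e (a * b) 1 = (σ.comorphism a).leadingCoeff * σ.topCoeff δ e b 1 +
      σ.topCoeff δ e a 1 * (σ.comorphism b).leadingCoeff := by
  rw [topCoeff_mul hδ ha hb]
  simp [Finset.Nat.antidiagonal_succ, topCoeff_zero]

theorem topCoeff_pow_one {σ : GaAction K A} {δ : Derivation K A A} {e : ℕ}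
    (hδ : ∀ h, (σ.comorphism (δ h)).natDegree ≤ (σ.comorphism h).natDegree + e) {a : A}
    (ha : a ≠ 0) (n : ℕ) :
    σ.topCoeff δ e (a ^ (n + 1)) 1 =
      (n + 1) * (σ.comorphism a).leadingCoeff ^ n * σ.topCoeff δ e a 1 := by
  induction n with
  | zero => simp
  | succ n ih =>
    rw [pow_succ, topCoeff_mul_one hδ (pow_ne_zero _ ha) ha, ih, map_pow, leadingCoeff_pow]
    push_cast
    ring

variable [CharZero K]

/-- A locally finite derivation of positive degree acts locally nilpotently on leading forms, so
that it cannot map an element to a nonzero multiple of itself in leading degree. -/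
theorem not_isLocallyFinite_of_dvd {σ : GaAction K A} {δ : Derivation K A A} {e : ℕ} (he : 0 < e)
    (hδ : ∀ h, (σ.comorphism (δ h)).natDegree ≤ (σ.comorphism h).natDegree + e) {f : A}
    (hf : σ.topCoeff δ e f 1 ≠ 0) (hdvd : f ∣ δ f) : ¬ IsLocallyFinite δ := by
  intro hlf
  obtain ⟨w, hw⟩ := hdvd
  have hδf : δ f ≠ 0 := fun h0 => hf (by simp [topCoeff, h0])
  have hf0 : f ≠ 0 := fun h0 => hδf (by rw [h0, map_zero])
  have hw0 : w ≠ 0 := fun h0 => hδf (by rw [hw, h0, mul_zero])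
  have hlast : ∀ h, h ≠ 0 → ∃ N, σ.topCoeff δ e h N ≠ 0 ∧ ∀ n, N < n → σ.topCoeff δ e h n = 0 := by
    classical
    intro h hh
    have hex := topCoeff_eventually_zero (σ := σ) he hlf h
    refine ⟨Nat.find hex, fun h0 => ?_, Nat.find_spec hex⟩
    rcases Nat.eq_zero_or_pos (Nat.find hex) with hz | hp
    · rw [hz, topCoeff_zero, leadingCoeff_eq_zero] at h0
      exact σ.comorphism_ne_zero hh h0
    · refine Nat.find_min hex (Nat.sub_one_lt_of_lt hp) fun n hn => ?_
      rcases eq_or_lt_of_le (show Nat.find hex ≤ n by omega) with rfl | hlt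
      · exact h0
      · exact Nat.find_spec hex n hlt
  obtain ⟨N, hN, hN'⟩ := hlast f hf0
  obtain ⟨M, hM, hM'⟩ := hlast w hw0
  have hdeg : (σ.comorphism (δ f)).natDegree = (σ.comorphism f).natDegree + e :=
    le_antisymm (hδ f) (le_natDegree_of_ne_zero (by simpa [topCoeff] using hf))
  -- The degree jump at `f` is exactly `e`, so passing from `f` to `δ f` only shifts the index. With
  -- `δ f = f * w`, the Leibniz sum at `N + M` has a single nonzero term, whereas the shifted index
  -- `N + M + 1` is beyond `N`.
  have hshift : σ.topCoeff δ e (δ f) (N + M) = σ.topCoeff δ e f (N + M + 1) := by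
    rw [topCoeff, topCoeff, hdeg, Function.iterate_succ_apply]
    congr 1
    ring
  rw [hN' _ (by omega), hw, topCoeff_mul hδ hf0 hw0,
    Finset.sum_eq_single_of_mem (N, M) (Finset.HasAntidiagonal.mem_antidiagonal.2 rfl)] at hshift
  · have : CharZero A := charZero_of_injective_algebraMap (FaithfulSMul.algebraMap_injective K A)
    rw [nsmul_eq_mul] at hshift
    refine mul_ne_zero (Nat.cast_ne_zero.2 ?_) (mul_ne_zero hN hM) hshift
    exact (Nat.choose_pos (Nat.le_add_right N M)).ne'
  · rintro ⟨i, j⟩ hij hne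
    have hij' : i + j = N + M := Finset.HasAntidiagonal.mem_antidiagonal.1 hij
    rcases lt_trichotomy i N with hi | rfl | hi
    · simp only [hM' j (by omega), mul_zero, smul_zero]
    · exact absurd (by rw [show j = M by omega]) hne
    · simp only [hN' i hi, zero_mul, smul_zero]

/-- If some `g` in the kernel of `δ` is not in the kernel of `σ`, then the maximal degree jump of `δ`
is attained on the kernel of `σ`. -/
theorem exists_mem_ker_topCoeff_ne_zero {σ : GaAction K A} {δ : Derivation K A A} {c : ℕ}
    (hδ : ∀ h, (σ.comorphism (δ h)).natDegree ≤ (σ.comorphism h).natDegree + c)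
    {g h : A} (hg : σ.derivation g ≠ 0) (hg' : δ g = 0) (hh : σ.topCoeff δ c h 1 ≠ 0) :
    ∃ f, σ.derivation f = 0 ∧ σ.topCoeff δ c f 1 ≠ 0 := by
  by_contra! H
  have hA : CharZero A := charZero_of_injective_algebraMap (FaithfulSMul.algebraMap_injective K A)
  have hg0 : g ≠ 0 := fun h0 => hg (by rw [h0, map_zero])
  have hh0 : h ≠ 0 := fun h0 => hh (by simp [topCoeff, h0])
  obtain ⟨b, hb⟩ := Nat.exists_eq_succ_of_ne_zero
    (fun h0 => hg ((σ.natDegree_eq_zero_iff g).1 h0))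
  obtain ⟨p, hp⟩ := Nat.exists_eq_succ_of_ne_zero
    (fun h0 => hh (H h ((σ.natDegree_eq_zero_iff h).1 h0)))
  -- As `deg g = b + 1` and `deg h = p + 1`, these exponents equalise the degrees; the factors `α`,
  -- `β`, which lie in ker `∂`, then equalise the leading coefficients.
  set u := h ^ (b + 1) with hu
  set v := g ^ (p + 1) with hv
  have hu0 : u ≠ 0 := pow_ne_zero _ hh0
  have hv0 : v ≠ 0 := pow_ne_zero _ hg0
  set α := (σ.comorphism u).leadingCoeff with hα
  set β := (σ.comorphism v).leadingCoeff with hβ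
  have hα0 : α ≠ 0 := leadingCoeff_ne_zero.2 (σ.comorphism_ne_zero hu0)
  have hβ0 : β ≠ 0 := leadingCoeff_ne_zero.2 (σ.comorphism_ne_zero hv0)
  have hαk : σ.derivation α = 0 := σ.derivation_leadingCoeff u
  have hβk : σ.derivation β = 0 := σ.derivation_leadingCoeff v
  have hσα := σ.comorphism_of_derivation_eq_zero hαk
  have hσβ := σ.comorphism_of_derivation_eq_zero hβk
  have hdu : (σ.comorphism (β * u)).natDegree = (b + 1) * (p + 1) := by
    rw [map_mul, hσβ, natDegree_C_mul hβ0, hu, map_pow, natDegree_pow, hp]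
  have hdv : (σ.comorphism (α * v)).natDegree = (b + 1) * (p + 1) := by
    rw [map_mul, hσα, natDegree_C_mul hα0, hv, map_pow, natDegree_pow, hb, mul_comm]
  have hr : (σ.comorphism (β * u - α * v)).natDegree < (b + 1) * (p + 1) := by
    refine natDegree_lt_of_degree_lt (by positivity) ?_
    have h1 : (σ.comorphism (β * u)).degree = ((b + 1) * (p + 1) : ℕ) := by
      rw [degree_eq_natDegree (σ.comorphism_ne_zero (mul_ne_zero hβ0 hu0)), hdu]
    have h2 : (σ.comorphism (α * v)).degree = ((b + 1) * (p + 1) : ℕ) := by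
      rw [degree_eq_natDegree (σ.comorphism_ne_zero (mul_ne_zero hα0 hv0)), hdv]
    have := degree_sub_lt_left (h1.trans h2.symm)
      (σ.comorphism_ne_zero (mul_ne_zero hβ0 hu0)) (by
        rw [map_mul, map_mul, leadingCoeff_mul, leadingCoeff_mul, hσα, hσβ, leadingCoeff_C,
          leadingCoeff_C, mul_comm])
    rwa [h1, ← map_sub] at this
  -- The difference `β * u - α * v` has smaller degree, so its image cannot reach the top degree.
  -- Under `H`, the right side vanishes because `δ g = 0`, while the left is a nonzero multiple of
  -- the top coefficient of `h`.
  have htop : σ.topCoeff δ c (β * u) 1 = σ.topCoeff δ c (α * v) 1 := by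
    have h0 : (σ.comorphism (δ (β * u - α * v))).coeff ((b + 1) * (p + 1) + 1 * c) = 0 :=
      coeff_eq_zero_of_natDegree_lt (by have := hδ (β * u - α * v); omega)
    rw [topCoeff, topCoeff, hdu, hdv, ← sub_eq_zero, ← coeff_sub, ← map_sub]
    rw [map_sub] at h0
    exact h0
  have hg1 : σ.topCoeff δ c g 1 = 0 := by simp [topCoeff, hg']
  rw [topCoeff_mul_one hδ hβ0 hu0, topCoeff_mul_one hδ hα0 hv0, H α hαk, H β hβk, hv,
    topCoeff_pow_one hδ hg0, hg1, hu, topCoeff_pow_one hδ hh0] at htop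
  simp only [mul_zero, zero_mul, add_zero, hσβ, leadingCoeff_C] at htop
  refine mul_ne_zero hβ0 (mul_ne_zero (mul_ne_zero (Nat.cast_add_one_ne_zero b)
    (pow_ne_zero _ (leadingCoeff_ne_zero.2 (σ.comorphism_ne_zero hh0)))) hh) htop

end

/-! ### The automorphism exp(`f`·`∂`) and its effect on degrees. -/

section

variable [IsDomain A] [CharZero K]

theorem expAut_smul_eq_eval (σ : GaAction K A) {f : A} (hf : σ.derivation f = 0) (h : A) :
    expAut (f • σ.derivation) (σ.isLocallyNilpotent.smul hf) 1 h = (σ.comorphism h).eval f := by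
  rw [expAut_smul_apply σ.isLocallyNilpotent hf
    (σ.iterate_derivation_eq_zero (Nat.lt_succ_self (σ.comorphism h).natDegree)),
    eval_eq_sum_range]
  refine Finset.sum_congr rfl fun j _ => ?_
  rw [comorphism_coeff, mul_comm, smul_mul_assoc]

theorem dvd_expAut_sub (σ : GaAction K A) {f : A} (hf : σ.derivation f = 0) (h : A) :
    f ∣ expAut (f • σ.derivation) (σ.isLocallyNilpotent.smul hf) 1 h - h := by
  rw [expAut_smul_eq_eval _ hf]
  simpa [σ.zero_act] using sub_dvd_eval_sub f 0 (σ.comorphism h)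

/-- The automorphism commutes with `∂`, because `f` lies in ker `∂`. -/
theorem coeff_comorphism_expAut (σ : GaAction K A) {f : A} (hf : σ.derivation f = 0) (h : A)
    (n : ℕ) :
    (σ.comorphism (expAut (f • σ.derivation) (σ.isLocallyNilpotent.smul hf) 1 h)).coeff n =
      expAut (f • σ.derivation) (σ.isLocallyNilpotent.smul hf) 1 ((σ.comorphism h).coeff n) := by
  set θ := expAut (f • σ.derivation) (σ.isLocallyNilpotent.smul hf) 1 with hθ
  have hcomm : ∀ h, σ.derivation (θ h) = θ (σ.derivation h) := by
    intro h
    obtain ⟨n, hn⟩ := σ.isLocallyNilpotent h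
    have hn' : σ.derivation^[n] (σ.derivation h) = 0 := by
      rw [← Function.iterate_succ_apply, Function.iterate_succ_apply', hn, map_zero]
    rw [hθ, expAut_smul_apply σ.isLocallyNilpotent hf hn,
      expAut_smul_apply σ.isLocallyNilpotent hf hn', map_sum]
    refine Finset.sum_congr rfl fun j _ => ?_
    rw [Derivation.map_smul, Derivation.leibniz, map_pow_eq_zero hf, smul_zero, add_zero,
      smul_eq_mul, ← Function.iterate_succ_apply, Function.iterate_succ_apply']
  have hiter : ∀ n, σ.derivation^[n] (θ h) = θ (σ.derivation^[n] h) := by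
    intro n
    induction n with
    | zero => rfl
    | succ n ih => rw [Function.iterate_succ_apply', ih, hcomm, Function.iterate_succ_apply']
  rw [comorphism_coeff, comorphism_coeff, hiter, map_smul]

theorem expAut_eq_self (σ : GaAction K A) {f : A} (hf : σ.derivation f = 0) {h : A}
    (hh : σ.derivation h = 0) :
    expAut (f • σ.derivation) (σ.isLocallyNilpotent.smul hf) 1 h = h := by
  rw [expAut_smul_eq_eval _ hf, σ.comorphism_of_derivation_eq_zero hh, eval_C]

theorem natDegree_expAut_le (σ : GaAction K A) {f : A} (hf : σ.derivation f = 0) (h : A) :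
    (σ.comorphism h).natDegree ≤
      (σ.comorphism (expAut (f • σ.derivation) (σ.isLocallyNilpotent.smul hf) 1 h)).natDegree := by
  rcases eq_or_ne h 0 with rfl | hh
  · simp
  · refine le_natDegree_of_ne_zero ?_
    rw [coeff_comorphism_expAut _ hf, coeff_natDegree, σ.expAut_eq_self hf (σ.derivation_leadingCoeff h)]
    exact leadingCoeff_ne_zero.2 (σ.comorphism_ne_zero hh)

/-- The leading coefficient lies in ker `∂`, hence is fixed and cancels. -/
theorem natDegree_expAut_sub_le (σ : GaAction K A) {f : A} (hf : σ.derivation f = 0) (h : A) :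
    (σ.comorphism (expAut (f • σ.derivation) (σ.isLocallyNilpotent.smul hf) 1 h - h)).natDegree ≤
      (σ.comorphism h).natDegree - 1 := by
  refine natDegree_le_iff_coeff_eq_zero.2 fun n hn => ?_
  rw [map_sub, coeff_sub, coeff_comorphism_expAut _ hf, sub_eq_zero]
  rcases eq_or_lt_of_le (show (σ.comorphism h).natDegree ≤ n by omega) with rfl | hlt
  · exact σ.expAut_eq_self hf (σ.derivation_leadingCoeff h)
  · rw [coeff_eq_zero_of_natDegree_lt hlt, map_zero]

/-- The coefficient below the leading one is killed by `∂` twice, so its exponential series stops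
after the linear term. -/
theorem coeff_comorphism_expAut_sub (σ : GaAction K A) {f : A} (hf : σ.derivation f = 0) (h : A)
    {n : ℕ} (hn : (σ.comorphism h).natDegree = n + 1) :
    (σ.comorphism (expAut (f • σ.derivation) (σ.isLocallyNilpotent.smul hf) 1 h - h)).coeff n =
      (n + 1) * f * (σ.comorphism h).leadingCoeff := by
  have h1 : σ.derivation ((σ.comorphism h).coeff n) = (σ.comorphism h).leadingCoeff * (n + 1) := by
    rw [derivation_coeff, leadingCoeff, hn]
  have h2 : σ.derivation^[2] ((σ.comorphism h).coeff n) = 0 := by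
    rw [Function.iterate_succ_apply, h1, Function.iterate_one, Derivation.leibniz,
      σ.derivation_leadingCoeff]
    simp
  rw [map_sub, coeff_sub, coeff_comorphism_expAut _ hf,
    expAut_smul_apply σ.isLocallyNilpotent hf h2, Finset.sum_range_succ, Finset.sum_range_one]
  simp [h1]
  ring

end

end GaAction

end

/-! ### Boundedness of degree jumps, and the derivation that is not locally finite. -/

section

variable {K : Type u} {A : Type v} [Field K] [CommRing A] [Algebra K A]

theorem exists_polynomial_of_mem_adjoin_insert {T : Set A} {s x : A}
    (hx : x ∈ Algebra.adjoin K (insert s T)) :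
    ∃ P : A[X], (∀ i, P.coeff i ∈ Algebra.adjoin K T) ∧ P.eval s = x := by
  induction hx using Algebra.adjoin_induction with
  | mem x hx =>
    rcases hx with rfl | hx
    · refine ⟨X, fun i => ?_, eval_X⟩
      rw [coeff_X]
      split_ifs
      · exact one_mem _
      · exact zero_mem _
    · refine ⟨C x, fun i => ?_, eval_C⟩
      rw [coeff_C]
      split_ifs
      · exact Algebra.subset_adjoin hx
      · exact zero_mem _
  | algebraMap r =>
    refine ⟨C (algebraMap K A r), fun i => ?_, eval_C⟩
    rw [coeff_C]
    split_ifs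
    · exact Subalgebra.algebraMap_mem _ r
    · exact zero_mem _
  | add x y _ _ hx hy =>
    obtain ⟨P, hP, rfl⟩ := hx
    obtain ⟨Q, hQ, rfl⟩ := hy
    exact ⟨P + Q, fun i => by rw [coeff_add]; exact add_mem (hP i) (hQ i), eval_add⟩
  | mul x y _ _ hx hy =>
    obtain ⟨P, hP, rfl⟩ := hx
    obtain ⟨Q, hQ, rfl⟩ := hy
    exact ⟨P * Q, fun i => by
      rw [coeff_mul]; exact sum_mem fun j _ => mul_mem (hP _) (hQ _), eval_mul⟩

namespace GaAction

variable [CharZero K] [IsDomain A]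

/-- After inverting `∂s`, the algebra is generated by `s` over ker `∂`; repeated division by powers
of `s` only collects leading coefficients, which lie in the kernel. -/
theorem exists_finset_pow_mul_mem_adjoin (σ : GaAction K A) {s : A} (hs : σ.derivation s ≠ 0)
    (hs2 : σ.derivation (σ.derivation s) = 0) (h : A) :
    ∃ T : Finset A, (∀ b ∈ T, σ.derivation b = 0) ∧
      ∃ M : ℕ, σ.derivation s ^ M * h ∈ Algebra.adjoin K (insert s (T : Set A)) := by
  classical
  suffices H : ∀ n h, (σ.comorphism h).natDegree = n → ∃ T : Finset A,
      (∀ b ∈ T, σ.derivation b = 0) ∧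
      ∃ M : ℕ, σ.derivation s ^ M * h ∈ Algebra.adjoin K (insert s (T : Set A)) from H _ h rfl
  intro n
  induction n using Nat.strong_induction_on with
  | _ n ih =>
    intro h hn
    rcases Nat.eq_zero_or_pos n with h0 | hpos
    · refine ⟨{h}, fun b hb => ?_, 0, ?_⟩
      · rw [Finset.mem_singleton.1 hb]
        exact (σ.natDegree_eq_zero_iff h).1 (hn.trans h0)
      · rw [pow_zero, one_mul]
        exact Algebra.subset_adjoin (by simp)
    · obtain ⟨T, hT, M, hM⟩ := ih _ (σ.natDegree_sub_local_slice_pow_lt hs hs2 hpos hn) _ rfl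
      set c := (σ.comorphism h).leadingCoeff with hc
      set U : Finset A := insert c (insert (σ.derivation s) T) with hU
      have hsub : insert s (T : Set A) ⊆ insert s (U : Set A) :=
        Set.insert_subset_insert fun x hx => by simp [hU, show x ∈ T from hx]
      have hcU : c ∈ Algebra.adjoin K (insert s (U : Set A)) :=
        Algebra.subset_adjoin (by simp [hU])
      have hsU : σ.derivation s ∈ Algebra.adjoin K (insert s (U : Set A)) :=
        Algebra.subset_adjoin (by simp [hU])
      have hs' : s ∈ Algebra.adjoin K (insert s (U : Set A)) :=
        Algebra.subset_adjoin (by simp)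
      refine ⟨U, fun b hb => ?_, M + n, ?_⟩
      · rcases Finset.mem_insert.1 hb with rfl | hb
        · exact σ.derivation_leadingCoeff h
        · rcases Finset.mem_insert.1 hb with rfl | hb
          · exact hs2
          · exact hT b hb
      · have := add_mem (Algebra.adjoin_mono hsub hM)
          (mul_mem (pow_mem hsU M) (mul_mem hcU (pow_mem hs' n)))
        convert this using 1
        ring

theorem exists_finset_forall_pow_mul_mem_adjoin [Algebra.FiniteType K A] (σ : GaAction K A) {s : A}
    (hs : σ.derivation s ≠ 0) (hs2 : σ.derivation (σ.derivation s) = 0) :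
    ∃ T : Finset A, (∀ b ∈ T, σ.derivation b = 0) ∧
      ∀ h, ∃ M : ℕ, σ.derivation s ^ M * h ∈ Algebra.adjoin K (insert s (T : Set A)) := by
  classical
  obtain ⟨S, hS⟩ := Algebra.FiniteType.out (R := K) (A := A)
  choose T hT M hM using σ.exists_finset_pow_mul_mem_adjoin (K := K) hs hs2
  refine ⟨insert (σ.derivation s) (S.biUnion T), fun b hb => ?_, fun h => ?_⟩
  · rcases Finset.mem_insert.1 hb with rfl | hb
    · exact hs2
    · obtain ⟨a, -, ha⟩ := Finset.mem_biUnion.1 hb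
      exact hT a b ha
  set B := Algebra.adjoin K (insert s ((insert (σ.derivation s) (S.biUnion T) : Finset A) : Set A))
    with hB
  have hsB : σ.derivation s ∈ B := Algebra.subset_adjoin (by simp)
  have hh : h ∈ Algebra.adjoin K (S : Set A) := hS ▸ Algebra.mem_top
  induction hh using Algebra.adjoin_induction with
  | mem x hx =>
    refine ⟨M x, Algebra.adjoin_mono (Set.insert_subset_insert fun y hy => ?_) (hM x)⟩
    exact Finset.mem_insert_of_mem (Finset.mem_biUnion.2 ⟨x, hx, hy⟩)
  | algebraMap r => exact ⟨0, by rw [pow_zero, one_mul]; exact Subalgebra.algebraMap_mem _ r⟩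
  | add x y _ _ hx hy =>
    obtain ⟨a, ha⟩ := hx
    obtain ⟨b, hb⟩ := hy
    refine ⟨a + b, ?_⟩
    have := add_mem (mul_mem (pow_mem hsB b) ha) (mul_mem (pow_mem hsB a) hb)
    convert this using 1
    ring
  | mul x y _ _ hx hy =>
    obtain ⟨a, ha⟩ := hx
    obtain ⟨b, hb⟩ := hy
    refine ⟨a + b, ?_⟩
    have := mul_mem ha hb
    convert this using 1
    ring

theorem natDegree_comorphism_eval_local_slice (σ : GaAction K A) {s : A} (hs : σ.derivation s ≠ 0)
    (hs2 : σ.derivation (σ.derivation s) = 0) {P : A[X]}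
    (hP : ∀ i, σ.derivation (P.coeff i) = 0) :
    (σ.comorphism (P.eval s)).natDegree = P.natDegree := by
  have h : σ.comorphism (P.eval s) = P.comp (C (σ.derivation s) * X + C s) := by
    rw [eval_eq_sum_range, map_sum, comp, eval₂_eq_sum_range]
    refine Finset.sum_congr rfl fun i _ => ?_
    rw [map_mul, map_pow, σ.comorphism_of_derivation_eq_zero (hP i), σ.comorphism_local_slice hs2]
  rw [h, natDegree_comp, natDegree_linear hs, mul_one]

/-- The degree jumps of a derivation of a finitely generated algebra are bounded. -/
theorem exists_natDegree_derivation_le [Algebra.FiniteType K A] (σ : GaAction K A)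
    (hσ : σ.IsNontrivial) (δ : Derivation K A A) :
    ∃ c, ∀ h, (σ.comorphism (δ h)).natDegree ≤ (σ.comorphism h).natDegree + c := by
  obtain ⟨s, hs, hs2⟩ := σ.exists_local_slice hσ
  -- The kernel need not be finitely generated; a finite part of it suffices up to powers of `∂s`.
  obtain ⟨T, hT, hmem⟩ := σ.exists_finset_forall_pow_mul_mem_adjoin (K := K) hs hs2
  have hker : ∀ b ∈ Algebra.adjoin K (T : Set A), σ.derivation b = 0 := by
    intro b hb
    induction hb using Algebra.adjoin_induction with
    | mem x hx => exact hT x hx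
    | algebraMap r => exact σ.derivation.map_algebraMap r
    | add x y _ _ hx hy => rw [map_add, hx, hy, add_zero]
    | mul x y _ _ hx hy => rw [Derivation.leibniz, hx, hy, smul_zero, smul_zero, add_zero]
  have hds : (σ.comorphism s).natDegree = 1 := by
    rw [σ.comorphism_local_slice hs2, natDegree_linear hs]
  have hd0 : ∀ b, σ.derivation b = 0 → (σ.comorphism b).natDegree = 0 :=
    fun b => (σ.natDegree_eq_zero_iff b).2
  have hmul : ∀ x y, (σ.comorphism (x * y)).natDegree ≤
      (σ.comorphism x).natDegree + (σ.comorphism y).natDegree := fun x y => by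
    rw [map_mul]; exact natDegree_mul_le
  have hadd : ∀ x y m, (σ.comorphism x).natDegree ≤ m → (σ.comorphism y).natDegree ≤ m →
      (σ.comorphism (x + y)).natDegree ≤ m := fun x y m hx hy => by
    rw [map_add]; exact (natDegree_add_le _ _).trans (max_le hx hy)
  set c₀ := T.sup fun b => (σ.comorphism (δ b)).natDegree with hc₀
  have hB : ∀ b ∈ Algebra.adjoin K (T : Set A), (σ.comorphism (δ b)).natDegree ≤ c₀ := by
    intro b hb
    induction hb using Algebra.adjoin_induction with
    | mem x hx => exact Finset.le_sup (f := fun b => (σ.comorphism (δ b)).natDegree) hx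
    | algebraMap r => simp
    | add x y _ _ hx hy => rw [map_add]; exact hadd _ _ _ hx hy
    | mul x y hx' hy' hx hy =>
      rw [Derivation.leibniz, smul_eq_mul, smul_eq_mul]
      refine hadd _ _ _ ((hmul _ _).trans ?_) ((hmul _ _).trans ?_)
      · rw [hd0 x (hker x hx')]; omega
      · rw [hd0 y (hker y hy')]; omega
  set c := c₀ + (σ.comorphism (δ s)).natDegree + (σ.comorphism (δ (σ.derivation s))).natDegree
    with hc
  refine ⟨c, fun h => ?_⟩
  rcases eq_or_ne (δ h) 0 with h0 | h0
  · simp [h0]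
  obtain ⟨M, hM⟩ := hmem h
  obtain ⟨P, hPT, hPe⟩ := exists_polynomial_of_mem_adjoin_insert hM
  have hpow : ∀ m, σ.derivation (σ.derivation s ^ m) = 0 := map_pow_eq_zero hs2
  have hdeg : P.natDegree = (σ.comorphism h).natDegree := by
    rw [← σ.natDegree_comorphism_eval_local_slice hs hs2 (fun i => hker _ (hPT i)), hPe, map_mul,
      σ.comorphism_of_derivation_eq_zero (hpow M), natDegree_C_mul (pow_ne_zero M hs)]
  have hspow : ∀ i, (σ.comorphism (s ^ i)).natDegree = i := fun i => by
    rw [map_pow, natDegree_pow, hds, mul_one]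
  have hx : (σ.comorphism (δ (P.eval s))).natDegree ≤ (σ.comorphism h).natDegree + c := by
    rw [eval_eq_sum_range, map_sum, map_sum]
    refine natDegree_sum_le_of_forall_le _ _ fun i hi => ?_
    have hi' : i ≤ (σ.comorphism h).natDegree := by
      rw [← hdeg]; exact Nat.lt_succ_iff.1 (Finset.mem_range.1 hi)
    rw [Derivation.leibniz, Derivation.leibniz_pow]
    simp only [smul_eq_mul, nsmul_eq_mul]
    refine hadd _ _ _ ((hmul _ _).trans ?_) ((hmul _ _).trans ?_)
    · rw [hd0 _ (hker _ (hPT i)), zero_add]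
      refine (hmul _ _).trans ?_
      have h1 : (σ.comorphism ((i : A))).natDegree = 0 := by simp
      have h2 := hmul (s ^ (i - 1)) (δ s)
      have h3 := hspow (i - 1)
      omega
    · have := hB _ (hPT i)
      rw [hspow]
      omega
  -- The exponent `M` depends on `h`, but the derivative of `∂s ^ M` has degree at most that of `δ
  -- (∂s)`, so the bound `c` does not.
  have hsplit : σ.derivation s ^ M * δ h = δ (P.eval s) + - (h * δ (σ.derivation s ^ M)) := by
    rw [hPe, Derivation.leibniz]
    simp only [smul_eq_mul]
    ring
  have hlast : (σ.comorphism (σ.derivation s ^ M * δ h)).natDegree ≤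
      (σ.comorphism h).natDegree + c := by
    rw [hsplit]
    refine hadd _ _ _ hx ?_
    rw [map_neg, natDegree_neg]
    refine (hmul _ _).trans (Nat.add_le_add_left ?_ _)
    rw [Derivation.leibniz_pow]
    simp only [smul_eq_mul, nsmul_eq_mul]
    have h1 : (σ.comorphism ((M : A))).natDegree = 0 := by simp
    have h2 := hmul (M : A) (σ.derivation s ^ (M - 1) * δ (σ.derivation s))
    have h3 := hmul (σ.derivation s ^ (M - 1)) (δ (σ.derivation s))
    have h4 := hd0 _ (hpow (M - 1))
    omega
  rwa [map_mul, σ.comorphism_of_derivation_eq_zero (hpow M), natDegree_C_mul (pow_ne_zero M hs)]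
    at hlast

end GaAction

variable [CharZero K] [IsDomain A]

theorem exists_not_isLocallyFinite [Algebra.FiniteType K A] (σ τ : GaAction K A)
    (hσ : σ.IsNontrivial) {f₀ g : A}
    (hf₀ : σ.derivation f₀ = 0) (hf₀' : τ.derivation f₀ ≠ 0) (hg : τ.derivation g = 0)
    (hg' : σ.derivation g ≠ 0) :
    ∃ δ ∈ Submodule.span K (LND K A), ¬ IsLocallyFinite δ := by
  classical
  have hex := σ.exists_natDegree_derivation_le hσ τ.derivation
  set c := Nat.find hex with hc
  have hτ : ∀ h, (σ.comorphism (τ.derivation h)).natDegree ≤ (σ.comorphism h).natDegree + c :=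
    Nat.find_spec hex
  have hlead : ∀ h, τ.derivation h ≠ 0 →
      (σ.comorphism (τ.derivation h)).natDegree = (σ.comorphism h).natDegree + c →
      σ.topCoeff τ.derivation c h 1 ≠ 0 := fun h h0 h1 => by
    rw [GaAction.topCoeff, one_mul, ← h1, Function.iterate_one, coeff_natDegree]
    exact leadingCoeff_ne_zero.2 (σ.comorphism_ne_zero h0)
  -- The least bound `c` is attained: for `c > 0` by minimality, for `c = 0` by `f₀`, since `D f₀`
  -- is nonzero of degree 0.
  obtain ⟨h, hh⟩ : ∃ h, σ.topCoeff τ.derivation c h 1 ≠ 0 := by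
    rcases Nat.eq_zero_or_pos c with h0 | hpos
    · refine ⟨f₀, hlead f₀ hf₀' ?_⟩
      have h1 := hτ f₀
      rw [(σ.natDegree_eq_zero_iff f₀).2 hf₀] at h1 ⊢
      omega
    · have h1 := Nat.find_min hex (Nat.sub_one_lt_of_lt hpos)
      push Not at h1
      obtain ⟨h, h1⟩ := h1
      refine ⟨h, hlead h (fun h0 => ?_) ?_⟩
      · rw [h0] at h1; simp at h1
      · have := hτ h
        omega
  obtain ⟨f, hf, hf1⟩ := GaAction.exists_mem_ker_topCoeff_ne_zero hτ hg' hg hh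
  have hdf : (σ.comorphism f).natDegree = 0 := (σ.natDegree_eq_zero_iff f).2 hf
  have hf2 : τ.derivation f ≠ 0 := fun h0 => hf1 (by simp [GaAction.topCoeff, h0])
  have hf0 : f ≠ 0 := fun h0 => hf2 (by rw [h0, map_zero])
  have hg0 : g ≠ 0 := fun h0 => hg' (by rw [h0, map_zero])
  have hdτf : (σ.comorphism (τ.derivation f)).natDegree = c := by
    refine le_antisymm (by simpa [hdf] using hτ f) (le_natDegree_of_ne_zero ?_)
    simpa [GaAction.topCoeff, hdf] using hf1
  obtain ⟨b, hb⟩ := Nat.exists_eq_succ_of_ne_zero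
    (fun h0 => hg' ((σ.natDegree_eq_zero_iff g).1 h0))
  -- `E` raises degrees by `2(b + 1) + c = e + 1`, and the difference with its conjugate loses one.
  -- The square of `g` ensures `e > 0` even when `b = c = 0`.
  set e := 2 * b + 1 + c with he
  set θ := expAut (f • σ.derivation) (σ.isLocallyNilpotent.smul hf) 1 with hθ
  set E : Derivation K A A := g ^ 2 • τ.derivation with hE
  have hEln : IsLocallyNilpotent E := τ.isLocallyNilpotent.smul (map_pow_eq_zero hg 2)
  have hdg : (σ.comorphism (g ^ 2)).natDegree = 2 * b + 2 := by
    rw [map_pow, natDegree_pow, hb]; omega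
  have hdE : ∀ h, (σ.comorphism (E h)).natDegree ≤ (σ.comorphism h).natDegree + (e + 1) := by
    intro h
    rw [hE, Derivation.smul_apply, smul_eq_mul, map_mul]
    refine natDegree_mul_le.trans ?_
    have := hτ h
    omega
  have hdEf : (σ.comorphism (E f)).natDegree = e + 1 := by
    rw [hE, Derivation.smul_apply, smul_eq_mul, map_mul,
      natDegree_mul (σ.comorphism_ne_zero (pow_ne_zero 2 hg0)) (σ.comorphism_ne_zero hf2), hdg,
      hdτf]
    omega
  have hEf0 : E f ≠ 0 := fun h0 => by rw [h0] at hdEf; simp at hdEf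
  have hθf : θ.symm f = f := by
    rw [AlgEquiv.symm_apply_eq]
    exact (σ.expAut_eq_self hf hf).symm
  set δ : Derivation K A A := conjDerivation θ E - E with hδ
  have hδf : δ f = θ (E f) - E f := by
    rw [hδ, Derivation.sub_apply, conjDerivation_apply, hθf]
  have hδdeg : ∀ h, (σ.comorphism (δ h)).natDegree ≤ (σ.comorphism h).natDegree + e := by
    intro h
    obtain ⟨y, rfl⟩ := θ.surjective h
    have hy := σ.natDegree_expAut_le hf y
    rw [← hθ] at hy
    -- Both terms contain `θ - 1`, which lowers positive degrees by at least one and kills degree 0.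
    have hsplit : δ (θ y) = (θ (E y) - E y) - E (θ y - y) := by
      rw [hδ, Derivation.sub_apply, conjDerivation_apply, AlgEquiv.symm_apply_apply, map_sub]
      ring
    rw [hsplit, map_sub]
    refine (natDegree_sub_le _ _).trans (max_le ?_ ?_)
    · have h1 := σ.natDegree_expAut_sub_le hf (E y)
      rw [← hθ] at h1
      have := hdE y
      omega
    · rcases Nat.eq_zero_or_pos (σ.comorphism y).natDegree with h0 | hpos
      · rw [hθ, σ.expAut_eq_self hf ((σ.natDegree_eq_zero_iff y).1 h0), sub_self, map_zero,
          map_zero, natDegree_zero]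
        exact Nat.zero_le _
      · have h1 := σ.natDegree_expAut_sub_le hf y
        rw [← hθ] at h1
        have := hdE (θ y - y)
        omega
  refine ⟨δ, Submodule.sub_mem _ (Submodule.subset_span (hEln.conj θ))
    (Submodule.subset_span hEln), ?_⟩
  refine GaAction.not_isLocallyFinite_of_dvd (e := e) (by omega) hδdeg (f := f) ?_ ?_
  -- As `deg f = 0` and `deg (E f) = e + 1`, the top coefficient is `(e + 1) * f` times the leading
  -- coefficient of `E f`.
  · rw [GaAction.topCoeff, Function.iterate_one, hδf, hdf, zero_add, one_mul,
      hθ, σ.coeff_comorphism_expAut_sub hf _ hdEf]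
    have : CharZero A := charZero_of_injective_algebraMap (FaithfulSMul.algebraMap_injective K A)
    exact mul_ne_zero (mul_ne_zero (Nat.cast_add_one_ne_zero e) hf0)
      (leadingCoeff_ne_zero.2 (σ.comorphism_ne_zero hEf0))
  · rw [hδf]
    exact σ.dvd_expAut_sub hf (E f)

end

end AffineVariety

theorem mainTheorem3 {K : Type u} [Field K] [IsAlgClosed K] [CharZero K]
    {A : Type v} [CommRing A] [IsDomain A] [Algebra K A] [Algebra.FiniteType K A]
    (hX : ∃ σ τ : AffineVariety.GaAction K A,
      σ.IsNontrivial ∧ τ.IsNontrivial ∧ ¬ σ.Equivalent τ) :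
    (∃ δ ∈ Submodule.span K (AffineVariety.LND K A), ¬ AffineVariety.IsLocallyFinite δ) ∧
    (∃ g ∈ AffineVariety.unipotentSubgroup K A, ¬ AffineVariety.IsAlgebraicElement g) := by
  obtain ⟨σ, τ, hσ, hτ, hne⟩ := hX
  obtain ⟨f, hf, hf'⟩ := AffineVariety.GaAction.exists_mem_ker_not_mem_ker hσ hτ hne
  obtain ⟨g, hg, hg'⟩ := AffineVariety.GaAction.exists_mem_ker_not_mem_ker hτ hσ
    fun h => hne fun x => (h x).symm
  exact ⟨AffineVariety.exists_not_isLocallyFinite σ τ hσ hf hf' hg hg',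
    AffineVariety.exists_not_isAlgebraicElement σ τ hf hf' hg hg'⟩
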